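/- Let $\alpha$ be a real random variable such that, for some $\theta_0\in(0,\pi/2)$, $\mathbf P[|\alpha|<\theta_0]=1$ and $\mathbf P[\alpha\ge x]=\mathbf P[\alpha\le -x]$ for all $x\in\mathbb R$, and suppose that $\alpha$ is not almost surely equal to a constant. Let $\gamma<1$ and $g(x)=x^\gamma$. For $A\ge 1$ let $\mathcal D=\{(x,y)\in\mathbb R^2: x>A,\ |y|<g(x)\}$ with boundary $\partial\mathcal D$, and let $\alpha_0,\alpha_1,\alpha_2,\dots$ be i.i.d. copies of $\alpha$. Let $\xi=(\xi_n)_{n\ge 0}$ be the following process on $\partial\mathcal D\cup\{\infty\}$, started from a given point $\xi_0\in\partial\mathcal D$ with $\xi_0^{(1)}>2A$. The state $\infty$ is absorbing. If $\xi_n\in\partial\mathcal D$, draw from $\xi_n$ the ray at angle $\alpha_n$ to the inward normal of $\partial\mathcal D$ at $\xi_n$, positive angles being to the right of the normal (towards larger $x$) and negative angles to the left. If the ray does not meet $\partial\mathcal D\setminus\{\xi_n\}$, then $\xi_{n+1}=\infty$; otherwise let $(x,y)$ be the first point of $\partial\mathcal D\setminus\{\xi_n\}$ on the ray, and put $\xi_{n+1}=(2A,g(2A))$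 if $x=A$ and $\xi_{n+1}=(x,y)$ if $x\ne A$. Let $\sigma_A=\inf\{n\ge 0:\xi_n\neq\infty,\ \xi^{(1)}_n\le 2A\}$ (with $\inf\emptyset=+\infty$), where $\xi_n^{(1)}$ is the first coordinate of $\xi_n$. The process $\xi$ is called null-recurrent if $\mathbf P[\sigma_A<\infty]=1$ and $\mathbf E[\sigma_A]=\infty$. Put $$\gamma_c=\frac{\mathbf E[\tan^2\alpha]}{1+2\,\mathbf E[\tan^2\alpha]}.$$ (i) Suppose $\gamma=\gamma_c>0$. Then there exists $A_0\in(0,\infty)$ such that for all $A>A_0$ (with $A\ge 1$) and all $\xi_0\in\partial\mathcal D$ with $\xi_0^{(1)}>2A$, $\xi$ is null-recurrent. (ii) Suppose $\gamma=-\mathbf E[\tan^2\alpha]<0$. Then there exists $A_0\in(0,\infty)$ such that for all $A>A_0$ (with $A\ge 1$) and all $\xi_0\in\partial\mathcal D$ with $\xi_0^{(1)}>2A$, $\xi$ is null-recurrent. -/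

import Mathlib

open MeasureTheory ProbabilityTheory
open scoped ENNReal

universe u

namespace StochasticBilliard

noncomputable section

/-- The tube `𝒟(g; A) = {(x, y) : x > A, |y| < g x}` in the plane. -/
def tube (g : ℝ → ℝ) (A : ℝ) : Set (ℝ × ℝ) :=
  {p | A < p.1 ∧ |p.2| < g p.1}

/-- The inward-pointing unit normal to the curve `y = ± g x` at its point `p = (x, ± g x)`
(downwards on the upper half of the boundary, upwards on the lower half). -/
def innerNormal (g : ℝ → ℝ) (p : ℝ × ℝ) : ℝ × ℝ :=
  (Real.sqrt (1 + deriv g p.1 ^ 2))⁻¹ • (deriv g p.1, -Real.sign p.2)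

/-- The unit tangent to the curve `y = ± g x` at its point `p = (x, ± g x)` that points to the
right, that is, with positive first coordinate. -/
def rightTangent (g : ℝ → ℝ) (p : ℝ × ℝ) : ℝ × ℝ :=
  (Real.sqrt (1 + deriv g p.1 ^ 2))⁻¹ • (1, Real.sign p.2 * deriv g p.1)

/-- The unit vector at angle `a` to the inward normal at `p`; positive angles lie to the right of
the normal, negative angles to the left. -/
def direction (g : ℝ → ℝ) (p : ℝ × ℝ) (a : ℝ) : ℝ × ℝ :=
  Real.cos a • innerNormal g p + Real.sin a • rightTangent g p

/-- The parameters `t > 0` at which the ray from `p` with angle `a` to the inward normal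
meets the boundary of the tube. -/
def hitParams (g : ℝ → ℝ) (A : ℝ) (p : ℝ × ℝ) (a : ℝ) : Set ℝ :=
  {t | 0 < t ∧ p + t • direction g p a ∈ frontier (tube g A)}

/-- The first point after `p` at which the ray from `p` with angle `a` meets the boundary
(meaningful if the ray meets the boundary). -/
def firstHit (g : ℝ → ℝ) (A : ℝ) (p : ℝ × ℝ) (a : ℝ) : ℝ × ℝ :=
  p + sInf (hitParams g A p a) • direction g p a

open Classical in
/-- One step of the collisions process driven by the angle `a`. The value `none` is the absorbing
state `∞` of a particle that never meets the boundary again. A particle that meets the vertical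
part `x = A` of the boundary is put at `(2A, g(2A))`. -/
def step (g : ℝ → ℝ) (A : ℝ) (s : Option (ℝ × ℝ)) (a : ℝ) : Option (ℝ × ℝ) :=
  match s with
  | none => none
  | some p =>
      if (hitParams g A p a).Nonempty then
        if (firstHit g A p a).1 = A then some (2 * A, g (2 * A))
        else some (firstHit g A p a)
      else none

/-- The collisions process `ξ` started at `p` and driven by the angles `α 0, α 1, …`. -/
def collisions {Ω : Type*} (g : ℝ → ℝ) (A : ℝ) (p : ℝ × ℝ) (α : ℕ → Ω → ℝ) :
    ℕ → Ω → Option (ℝ × ℝ)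
  | 0, _ => some p
  | n + 1, ω => step g A (collisions g A p α n ω) (α n ω)

/-- `σ_A = inf {n ≥ 0 : ξ_n⁽¹⁾ ≤ 2A}`, equal to `⊤` if there is no such `n`. -/
def returnTime {Ω : Type*} (A : ℝ) (ξ : ℕ → Ω → Option (ℝ × ℝ)) (ω : Ω) : ℕ∞ :=
  sInf ((fun n : ℕ => (n : ℕ∞)) '' {n : ℕ | ∃ q : ℝ × ℝ, ξ n ω = some q ∧ q.1 ≤ 2 * A})

/-- Recurrent (`σ_A` is almost surely finite), but not positive-recurrent (`σ_A` has infinite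
expectation). -/
def IsNullRecurrent {Ω : Type*} [MeasurableSpace Ω] (P : Measure Ω) (A : ℝ)
    (ξ : ℕ → Ω → Option (ℝ × ℝ)) : Prop :=
  (∀ᵐ ω ∂P, returnTime A ξ ω < ⊤) ∧
    ∫⁻ ω, (returnTime A ξ ω : ℝ≥0∞) ∂P = ⊤

/-- The assumption on the law `ν` of the reflection angle: it is bounded strictly away from
`± π/2` and symmetric about `0`. -/
def IsReflectionLaw (ν : Measure ℝ) : Prop :=
  (∃ a₀ ∈ Set.Ioo 0 (Real.pi / 2), ∀ᵐ x ∂ν, |x| < a₀) ∧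
    ∀ x : ℝ, ν (Set.Ici x) = ν (Set.Iic (-x))

/-- The angle is almost surely equal to a constant. -/
def IsDegenerate (ν : Measure ℝ) : Prop :=
  ∃ c : ℝ, ∀ᵐ x ∂ν, x = c

/-- `E[tan² α]` for an angle `α` with law `ν`. -/
def meanTanSq (ν : Measure ℝ) : ℝ :=
  ∫ x, Real.tan x ^ 2 ∂ν

/-- The critical exponent `γ_c = E[tan² α] / (1 + 2 E[tan² α])`. -/
def gammaCrit (ν : Measure ℝ) : ℝ :=
  meanTanSq ν / (1 + 2 * meanTanSq ν)

/-- For all large `A` (how large depends only on the law `ν` and the function `g`), the collisions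
process in the tube `𝒟(g; A)` with i.i.d. reflection angles of law `ν` is null-recurrent from every
starting point on the boundary with first coordinate greater than `2A`. -/
def NullRecurrentForLargeA (ν : Measure ℝ) (g : ℝ → ℝ) : Prop :=
  ∃ A₀ : ℝ, 0 < A₀ ∧ ∀ A : ℝ, 1 ≤ A → A₀ < A →
    ∀ (Ω : Type u) [MeasurableSpace Ω] (P : Measure Ω) [IsProbabilityMeasure P]
      (α : ℕ → Ω → ℝ), (∀ k, Measurable (α k)) → iIndepFun α P → (∀ k, P.map (α k) = ν) →
      ∀ p ∈ frontier (tube g A), 2 * A < p.1 →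
        IsNullRecurrent P A (collisions g A p α)

end

end StochasticBilliard

namespace StochasticBilliard

/-! Write ε = x^(γ-1), the width of the tube relative to the abscissa x, and m = E[tan² α]. For x >
2A with A large, every admissible ray crosses to the opposite wall and changes x by a factor between
1/2 and 3/2. So before time σ_A neither ∞ nor the side x = A is reached, and x performs a Markov
chain with i.i.d. inputs.

The relative jump is 2εt + 2γε²(1 + 2t²) + O(ε³) with t = tan α. The linear term averages to zero by
symmetry, so x^p has relative drift 2ε²·p·κ(p) + O(ε³), where κ(p) = `driftCoeff ν γ p` = γ(1 + 2m)
+ (p-1)m, and log x has drift 2ε²κ(0) + O(ε³). In the scale Y = x^(1-γ) = 1/ε this is a Lamperti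
problem: bounded jumps and drift O(1/Y). The chain should be null-recurrent when κ(0) ≤ 0 ≤ κ(2-2γ):
log x is then nearly a supermartingale, and Y² = x^(2-2γ) nearly a submartingale. The two cases of
the theorem are the ends of this range: κ(0) = 0 means γ = γ_c, and κ(2-2γ) = γ + m = 0 means γ =
-m.

At either end the leading drift vanishes, so a lower-order correction must supply the sign. With δ =
(1-γ)/2 and s = x^(-δ) = √ε, changing the exponent by δ gives a term of relative order s, which
beats the expansion error of relative order s² = ε. Thus log x - x^(-δ) is a strict supermartingale
and x^(4δ) - x^(3δ) a submartingale above 2A (`drift_log_le`, `drift_rpow_nonneg`).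

The supermartingale gives P[σ_A > n] → 0 (`IsKilledMap.tendsto_survival`). For the infinite mean, a
particle at height Y needs time of order Y² to come back. If E[σ_A] were finite, this would force
the expected submartingale, stopped at time n, to have upper limit at most its value at 2A, which is
below its initial value (`IsKilledMap.not_summable_survival`). -/

/-! ### Second-order expansions of powers and the logarithm at 1 -/

/-- `h z = b₁ z + b₂ z² + O(z³)` on `|z| ≤ 1/2`. -/
def HasQuadraticExpansion (h : ℝ → ℝ) (b₁ b₂ : ℝ) : Prop :=
  ∃ K : ℝ, 0 ≤ K ∧ ∀ z, |z| ≤ 1 / 2 → |h z - b₁ * z - b₂ * z ^ 2| ≤ K * |z| ^ 3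

/-- The mean value inequality on [-|z|, |z|] raises the order of vanishing by one. Three
applications give Taylor's estimate from a bound on the third derivative. -/
lemma abs_le_mul_pow_succ {h h' : ℝ → ℝ} {r K : ℝ} {n : ℕ} (hK : 0 ≤ K)
    (hd : ∀ z, |z| ≤ r → HasDerivAt h (h' z) z)
    (hb : ∀ z, |z| ≤ r → |h' z| ≤ K * |z| ^ n) (h0 : h 0 = 0) (z : ℝ) (hz : |z| ≤ r) :
    |h z| ≤ K * |z| ^ (n + 1) := by
  have hs : ∀ w ∈ Set.Icc (-|z|) |z|, |w| ≤ |z| := fun w hw => abs_le.2 hw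
  have key := Convex.norm_image_sub_le_of_norm_hasDerivWithin_le (f := h) (f' := h')
    (s := Set.Icc (-|z|) |z|) (C := K * |z| ^ n) (x := 0) (y := z)
    (fun w hw => (hd w ((hs w hw).trans hz)).hasDerivWithinAt)
    (fun w hw => by
      rw [Real.norm_eq_abs]
      refine (hb w ((hs w hw).trans hz)).trans ?_
      exact mul_le_mul_of_nonneg_left (pow_le_pow_left₀ (abs_nonneg _) (hs w hw) n) hK)
    (convex_Icc _ _) (by simp) ⟨neg_abs_le z, le_abs_self z⟩
  rw [h0, sub_zero, sub_zero, Real.norm_eq_abs, Real.norm_eq_abs] at key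
  rw [pow_succ, ← mul_assoc]
  exact key

lemma hasQuadraticExpansion_of_hasDerivAt {h h₁ h₂ h₃ : ℝ → ℝ} (h0 : h 0 = 0)
    (hd₀ : ∀ z, |z| ≤ 1 / 2 → HasDerivAt h (h₁ z) z)
    (hd₁ : ∀ z, |z| ≤ 1 / 2 → HasDerivAt h₁ (h₂ z) z)
    (hd₂ : ∀ z, |z| ≤ 1 / 2 → HasDerivAt h₂ (h₃ z) z)
    (hc : ContinuousOn h₃ (Set.Icc (-(1 / 2)) (1 / 2))) :
    HasQuadraticExpansion h (h₁ 0) (h₂ 0 / 2) := by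
  obtain ⟨K, hK⟩ := isCompact_Icc.exists_bound_of_continuousOn hc
  have hK0 : 0 ≤ K := (norm_nonneg _).trans (hK 0 (by norm_num))
  refine ⟨K, hK0, fun z hz => ?_⟩
  have e₂ : ∀ z, |z| ≤ 1 / 2 → |h₂ z - h₂ 0| ≤ K * |z| ^ (0 + 1) :=
    abs_le_mul_pow_succ (h := fun z => h₂ z - h₂ 0) hK0 (fun z hz => (hd₂ z hz).sub_const _)
      (fun z hz => by simpa using hK z (abs_le.1 hz)) (by simp)
  have e₁ : ∀ z, |z| ≤ 1 / 2 → |h₁ z - h₁ 0 - h₂ 0 * z| ≤ K * |z| ^ (0 + 1 + 1) :=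
    abs_le_mul_pow_succ (h := fun z => h₁ z - h₁ 0 - h₂ 0 * z) hK0
      (fun z hz => by
        simpa using ((hd₁ z hz).sub_const (h₁ 0)).fun_sub ((hasDerivAt_id z).const_mul (h₂ 0)))
      e₂ (by simp)
  refine abs_le_mul_pow_succ (h := fun z => h z - h₁ 0 * z - h₂ 0 / 2 * z ^ 2) hK0
    (fun z hz => ?_) e₁ (by simp [h0]) z hz
  have := ((hd₀ z hz).fun_sub ((hasDerivAt_id z).const_mul (h₁ 0))).fun_sub
    ((hasDerivAt_pow 2 z).const_mul (h₂ 0 / 2))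
  refine this.congr_deriv ?_
  norm_num
  ring

lemma hasDerivAt_one_add_rpow (p : ℝ) {z : ℝ} (hz : |z| ≤ 1 / 2) :
    HasDerivAt (fun z : ℝ => (1 + z) ^ p) (p * (1 + z) ^ (p - 1)) z := by
  have h1 : (1 + z) ≠ 0 := by linarith [(abs_le.1 hz).1]
  simpa using ((hasDerivAt_id z).const_add 1).rpow_const (p := p) (Or.inl h1)

lemma hasQuadraticExpansion_rpow (p : ℝ) :
    HasQuadraticExpansion (fun z => (1 + z) ^ p - 1) p (p * (p - 1) / 2) := by
  have := hasQuadraticExpansion_of_hasDerivAt (h := fun z => (1 + z) ^ p - 1)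
    (h₁ := fun z => p * (1 + z) ^ (p - 1))
    (h₂ := fun z => p * ((p - 1) * (1 + z) ^ (p - 1 - 1)))
    (h₃ := fun z => p * ((p - 1) * ((p - 1 - 1) * (1 + z) ^ (p - 1 - 1 - 1)))) (by simp)
    (fun z hz => (hasDerivAt_one_add_rpow p hz).sub_const 1)
    (fun z hz => (hasDerivAt_one_add_rpow (p - 1) hz).const_mul p)
    (fun z hz => ((hasDerivAt_one_add_rpow (p - 1 - 1) hz).const_mul (p - 1)).const_mul p)
    (fun z hz => ((((hasDerivAt_one_add_rpow (p - 1 - 1 - 1) (abs_le.2 hz)).const_mul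
      (p - 1 - 1)).const_mul (p - 1)).const_mul p).continuousAt.continuousWithinAt)
  simpa using this

lemma hasQuadraticExpansion_log :
    HasQuadraticExpansion (fun z => Real.log (1 + z)) 1 (-1 / 2) := by
  have h0 : ∀ z : ℝ, |z| ≤ 1 / 2 → (1 + z) ≠ 0 := fun z hz => by linarith [(abs_le.1 hz).1]
  have := hasQuadraticExpansion_of_hasDerivAt (h := fun z => Real.log (1 + z))
    (h₁ := fun z => (1 + z) ^ (-1 : ℝ))
    (h₂ := fun z => -1 * (1 + z) ^ (-1 - 1 : ℝ))
    (h₃ := fun z => -1 * ((-1 - 1) * (1 + z) ^ (-1 - 1 - 1 : ℝ))) (by simp)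
    (fun z hz => by
      have := ((hasDerivAt_id z).const_add 1).log (h0 z hz)
      rw [Real.rpow_neg_one]
      simpa using this)
    (fun z hz => hasDerivAt_one_add_rpow (-1) hz)
    (fun z hz => (hasDerivAt_one_add_rpow (-1 - 1) hz).const_mul (-1))
    (fun z hz => (((hasDerivAt_one_add_rpow (-1 - 1 - 1) (abs_le.2 hz)).const_mul
      (-1 - 1)).const_mul (-1)).continuousAt.continuousWithinAt)
  simpa using this

lemma exists_lipschitz_one_add_rpow (p : ℝ) :
    ∃ K : ℝ, 0 ≤ K ∧ ∀ z w, |z| ≤ 1 / 2 → |w| ≤ 1 / 2 →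
      |(1 + z) ^ p - (1 + w) ^ p| ≤ K * |z - w| := by
  have hc : ContinuousOn (fun z : ℝ => p * (1 + z) ^ (p - 1)) (Set.Icc (-(1 / 2)) (1 / 2)) :=
    fun z hz => ((hasDerivAt_one_add_rpow (p - 1)
      (abs_le.2 hz)).const_mul p).continuousAt.continuousWithinAt
  obtain ⟨K, hK⟩ := isCompact_Icc.exists_bound_of_continuousOn hc
  refine ⟨K, (norm_nonneg _).trans (hK 0 (by norm_num)), fun z w hz hw => ?_⟩
  exact Convex.norm_image_sub_le_of_norm_hasDerivWithin_le
    (fun u hu => (hasDerivAt_one_add_rpow p (abs_le.2 hu)).hasDerivWithinAt) hK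
    (convex_Icc _ _) (abs_le.1 hw) (abs_le.1 hz)

/-! ### One chord of the tube in scaled coordinates -/

/-- `v` is the scaled length of the vertical projection of a chord of the tube whose scaled
inverse slope is `c`. -/
def IsFlight (γ c v : ℝ) : Prop :=
  0 < v ∧ v ≤ 3 ∧ |c * v| ≤ 1 / 2 ∧ v = 1 + (1 + c * v) ^ γ ∧
    ∀ w, 0 < w → w < v → |1 - w| < (1 + c * w) ^ γ

/-- Abscissae are measured in units of x and heights in units of g(x). After descending by w the ray
is at height 1 - w over 1 + cw, so it meets the opposite wall when w - (1 + cw)^γ = 1. For small c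
the power is 1/4-Lipschitz in w on [0, 3], so the left side is strictly increasing and has a unique
root v. Substituting (1 + cv)^γ = 1 + γcv + O(c²) gives v = 2 + 2γc + O(c²). -/
lemma exists_flight (γ : ℝ) :
    ∃ v : ℝ → ℝ, Measurable v ∧ ∃ c₀ : ℝ, 0 < c₀ ∧ (∀ c, |c| ≤ c₀ → IsFlight γ c (v c)) ∧
      ∃ K : ℝ, 0 ≤ K ∧ ∀ c, |c| ≤ c₀ → |c * v c - 2 * c - 2 * γ * c ^ 2| ≤ K * |c| ^ 3 := by
  obtain ⟨L, hL0, hL⟩ := exists_lipschitz_one_add_rpow γ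
  obtain ⟨K, hK0, hK⟩ := hasQuadraticExpansion_rpow γ
  -- The bound 1/6 keeps |cw| ≤ 1/2 for w ≤ 3; the other bound makes the Lipschitz constant at most
  -- 1/4.
  set c₀ : ℝ := min (1 / 6) (1 / (4 * (L + 1))) with hc₀
  have hc₀pos : 0 < c₀ := by positivity
  have hc6 : ∀ c, |c| ≤ c₀ → |c| ≤ 1 / 6 := fun c hc => hc.trans (min_le_left _ _)
  have hcL : ∀ c, |c| ≤ c₀ → L * |c| ≤ 1 / 4 := fun c hc => by
    have h1 : |c| ≤ 1 / (4 * (L + 1)) := hc.trans (min_le_right _ _)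
    rw [le_div_iff₀ (by positivity)] at h1
    nlinarith [abs_nonneg c]
  have hcw : ∀ c w, |c| ≤ c₀ → 0 ≤ w → w ≤ 3 → |c * w| ≤ 1 / 2 := fun c w hc h0 h3 => by
    rw [abs_mul, abs_of_nonneg h0]
    nlinarith [hc6 c hc, abs_nonneg c]
  have hlip : ∀ c w w', |c| ≤ c₀ → 0 ≤ w → w ≤ 3 → 0 ≤ w' → w' ≤ 3 →
      |(1 + c * w) ^ γ - (1 + c * w') ^ γ| ≤ 1 / 4 * |w - w'| := fun c w w' hc h0 h3 h0' h3' => by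
    refine (hL _ _ (hcw c w hc h0 h3) (hcw c w' hc h0' h3')).trans ?_
    rw [← mul_sub, abs_mul, ← mul_assoc]
    exact mul_le_mul_of_nonneg_right (hcL c hc) (abs_nonneg _)
  have hex : ∀ c, |c| ≤ c₀ → ∃ v ∈ Set.Icc (0 : ℝ) 3, v - (1 + c * v) ^ γ = 1 := fun c hc => by
    have hcont : ContinuousOn (fun v : ℝ => v - (1 + c * v) ^ γ) (Set.Icc 0 3) := by
      intro v hv
      have h1 : 1 + c * v ≠ 0 := by linarith [(abs_le.1 (hcw c v hc hv.1 hv.2)).1]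
      have h2 : ContinuousAt (fun v : ℝ => (1 + c * v) ^ γ) v :=
        ContinuousAt.rpow_const (by fun_prop) (Or.inl h1)
      exact (continuousAt_id.sub h2).continuousWithinAt
    have h3 := (abs_le.1 (hlip c 3 0 hc (by norm_num) le_rfl le_rfl (by norm_num))).2
    norm_num at h3
    exact intermediate_value_Icc (by norm_num : (0 : ℝ) ≤ 3) hcont
      ⟨by norm_num, by linarith⟩
  classical
  choose! v₀ hv₀ hv₀e using hex
  have hmono : ∀ c w w', |c| ≤ c₀ → 0 ≤ w → w < w' → w' ≤ 3 →
      w - (1 + c * w) ^ γ < w' - (1 + c * w') ^ γ := fun c w w' hc h0 hww h3 => by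
    have := (abs_le.1 (hlip c w' w hc (h0.trans hww.le) h3 h0 (hww.le.trans h3))).2
    rw [abs_of_pos (sub_pos.2 hww)] at this
    linarith
  let v : ℝ → ℝ := fun c => if |c| ≤ c₀ then v₀ c else 0
  have hvv : ∀ c, |c| ≤ c₀ → v c = v₀ c := fun c hc => if_pos hc
  have hset : MeasurableSet {c : ℝ | |c| ≤ c₀} := measurableSet_le (by fun_prop) (by fun_prop)
  refine ⟨v, ?_, c₀, hc₀pos, ?_, ?_⟩
  · refine measurable_of_Iic fun b => ?_
    rcases lt_or_ge b 0 with hb | hb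
    · convert MeasurableSet.empty
      ext c
      simp only [Set.mem_preimage, Set.mem_Iic, Set.mem_empty_iff_false, iff_false, not_le, v]
      split_ifs with hc
      · exact hb.trans_le (hv₀ c hc).1
      · exact hb
    rcases lt_or_ge 3 b with hb3 | hb3
    · convert MeasurableSet.univ
      ext c
      simp only [Set.mem_preimage, Set.mem_Iic, Set.mem_univ, iff_true, v]
      split_ifs with hc
      · exact (hv₀ c hc).2.trans hb3.le
      · exact hb
    -- By monotonicity, for |c| ≤ c₀ the root is at most b exactly when the increasing function is
    -- already at least 1 at b, which is a measurable condition on c.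
    have hm : MeasurableSet {c : ℝ | 1 ≤ b - (1 + c * b) ^ γ} :=
      measurableSet_le (by fun_prop) (by fun_prop)
    convert hset.compl.union hm
    ext c
    simp only [Set.mem_preimage, Set.mem_Iic, Set.mem_union, Set.mem_compl_iff, Set.mem_ofPred_eq,
      v]
    split_ifs with hc
    · simp only [hc, not_true, false_or]
      rw [show 1 ≤ b - (1 + c * b) ^ γ ↔ v₀ c - (1 + c * v₀ c) ^ γ ≤ b - (1 + c * b) ^ γ by
        rw [hv₀e c hc]]
      constructor
      · intro h
        rcases h.eq_or_lt with h | h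
        · rw [h]
        · exact (hmono c _ _ hc (hv₀ c hc).1 h hb3).le
      · intro h
        by_contra! h'
        exact absurd (hmono c _ _ hc hb h' (hv₀ c hc).2) (not_lt.2 h)
    · simp [hc, hb]
  · intro c hc
    rw [hvv c hc]
    have he := hv₀e c hc
    obtain ⟨h0, h3⟩ := hv₀ c hc
    have hpos : 0 < v₀ c := by
      rcases h0.eq_or_lt with h | h
      · rw [← h] at he
        norm_num at he
      · exact h
    refine ⟨hpos, h3, hcw c _ hc h0 h3, by linarith, fun w hw hwv => abs_lt.2 ⟨?_, ?_⟩⟩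
    · linarith [hmono c w _ hc hw.le hwv h3]
    · have := (abs_le.1 (hlip c w 0 hc hw.le (hwv.le.trans h3) le_rfl (by norm_num))).1
      simp only [mul_zero, add_zero, Real.one_rpow, sub_zero, abs_of_pos hw] at this
      linarith
  · refine ⟨3 * |γ| * L + 9 * (K + |γ * (γ - 1) / 2|), by positivity, fun c hc => ?_⟩
    rw [hvv c hc]
    have he := hv₀e c hc
    obtain ⟨h0, h3⟩ := hv₀ c hc
    have hw := hcw c _ hc h0 h3
    have h1 : |v₀ c - 2| ≤ 3 * L * |c| := by
      have := hL (c * v₀ c) 0 hw (by norm_num)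
      rw [add_zero, Real.one_rpow, sub_zero, abs_mul, abs_of_nonneg h0] at this
      rw [show v₀ c - 2 = (1 + c * v₀ c) ^ γ - 1 by linarith]
      nlinarith [mul_nonneg hL0 (abs_nonneg c)]
    have h2 : |(1 + c * v₀ c) ^ γ - 1 - γ * (c * v₀ c)|
        ≤ 9 * (K + |γ * (γ - 1) / 2|) * |c| ^ 2 := by
      have hz : |c * v₀ c| ≤ 3 * |c| := by
        rw [abs_mul, abs_of_nonneg h0]
        nlinarith [abs_nonneg c]
      have e := hK _ hw
      have hz2 : |c * v₀ c| ^ 2 ≤ 9 * |c| ^ 2 := by nlinarith [abs_nonneg (c * v₀ c)]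
      have hz3 : |c * v₀ c| ^ 3 ≤ |c * v₀ c| ^ 2 := by
        rw [pow_succ]
        nlinarith [sq_nonneg |c * v₀ c|]
      calc _ = |((1 + c * v₀ c) ^ γ - 1 - γ * (c * v₀ c) - γ * (γ - 1) / 2 * (c * v₀ c) ^ 2)
            + γ * (γ - 1) / 2 * (c * v₀ c) ^ 2| := by ring_nf
        _ ≤ K * |c * v₀ c| ^ 2 + |γ * (γ - 1) / 2| * |c * v₀ c| ^ 2 := by
            refine (abs_add_le _ _).trans (add_le_add (e.trans ?_) ?_)
            · gcongr
            · rw [abs_mul, abs_pow]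
        _ = (K + |γ * (γ - 1) / 2|) * |c * v₀ c| ^ 2 := by ring
        _ ≤ (K + |γ * (γ - 1) / 2|) * (9 * |c| ^ 2) := by gcongr
        _ = _ := by ring
    have h4 : |γ * c * (v₀ c - 2)| ≤ |γ| * |c| * (3 * L * |c|) := by
      rw [abs_mul, abs_mul]
      gcongr
    calc |c * v₀ c - 2 * c - 2 * γ * c ^ 2|
        = |c| * |((1 + c * v₀ c) ^ γ - 1 - γ * (c * v₀ c)) + γ * c * (v₀ c - 2)| := by
          rw [← abs_mul]
          congr 1
          rw [show (1 + c * v₀ c) ^ γ = v₀ c - 1 by linarith]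
          ring
      _ ≤ |c| * (9 * (K + |γ * (γ - 1) / 2|) * |c| ^ 2 + |γ| * |c| * (3 * L * |c|)) := by
          gcongr
          exact (abs_add_le _ _).trans (add_le_add h2 h4)
      _ = _ := by ring

/-! ### Expansion of the relative jump in the scaled width -/

/-- The scaled inverse slope of the ray whose angle to the normal has tangent `t`, at a point
where the scaled width of the tube is `ε`. -/
noncomputable def inverseSlope (γ ε t : ℝ) : ℝ := ε * (t + γ * ε) / (1 - γ * ε * t)

lemma inverseSlope_expansion (γ : ℝ) {τ : ℝ} (hτ : 0 ≤ τ) {ε t : ℝ} (hε : 0 < ε) (ht : |t| ≤ τ)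
    (hs : |γ| * ε * τ ≤ 1 / 2) :
    1 / 2 ≤ 1 - γ * ε * t ∧
      |inverseSlope γ ε t - ε * t - γ * ε ^ 2 * (1 + t ^ 2)|
        ≤ 2 * γ ^ 2 * τ * (1 + τ ^ 2) * ε ^ 3 := by
  have h1 : |γ * ε * t| ≤ 1 / 2 := by
    rw [abs_mul, abs_mul, abs_of_pos hε]
    refine le_trans ?_ hs
    gcongr
  have h2 : 1 / 2 ≤ 1 - γ * ε * t := by linarith [(abs_le.1 h1).2]
  refine ⟨h2, ?_⟩
  have hne : 1 - γ * ε * t ≠ 0 := by linarith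
  have e : inverseSlope γ ε t - ε * t - γ * ε ^ 2 * (1 + t ^ 2)
      = γ ^ 2 * ε ^ 3 * (t * (1 + t ^ 2)) / (1 - γ * ε * t) := by
    rw [inverseSlope, eq_div_iff hne, sub_mul, sub_mul, div_mul_cancel₀ _ hne]
    ring
  have ht2 : t ^ 2 ≤ τ ^ 2 := sq_le_sq' (by linarith [(abs_le.1 ht).1]) (abs_le.1 ht).2
  rw [e, abs_div, abs_of_pos (by linarith : 0 < 1 - γ * ε * t), div_le_iff₀ (by linarith)]
  have h3 : |γ ^ 2 * ε ^ 3 * (t * (1 + t ^ 2))| ≤ γ ^ 2 * ε ^ 3 * (τ * (1 + τ ^ 2)) := by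
    rw [abs_mul, abs_mul t, abs_of_nonneg (by positivity : 0 ≤ γ ^ 2 * ε ^ 3),
      abs_of_nonneg (by positivity : 0 ≤ 1 + t ^ 2)]
    gcongr
  refine h3.trans ?_
  have h4 : 0 ≤ 2 * γ ^ 2 * τ * (1 + τ ^ 2) * ε ^ 3 := by positivity
  nlinarith

lemma exists_inverseSlope_bounds (γ : ℝ) {τ : ℝ} (hτ : 0 ≤ τ) :
    ∃ C : ℝ, 0 ≤ C ∧ ∃ ε₀ : ℝ, 0 < ε₀ ∧ ε₀ ≤ 1 ∧ ∀ ε t, 0 < ε → ε ≤ ε₀ → |t| ≤ τ →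
      0 < 1 - γ * ε * t ∧
      |inverseSlope γ ε t - ε * t - γ * ε ^ 2 * (1 + t ^ 2)| ≤ C * ε ^ 3 ∧
      |inverseSlope γ ε t - ε * t| ≤ C * ε ^ 2 ∧ |inverseSlope γ ε t| ≤ C * ε := by
  obtain ⟨C₃, hC₃, hC₃0⟩ : ∃ C₃, C₃ = 2 * γ ^ 2 * τ * (1 + τ ^ 2) ∧ 0 ≤ C₃ :=
    ⟨_, rfl, by positivity⟩
  obtain ⟨C₂, hC₂, hC₂0⟩ : ∃ C₂, C₂ = |γ| * (1 + τ ^ 2) ∧ 0 ≤ C₂ := ⟨_, rfl, by positivity⟩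
  have hpos : 0 < 1 / (2 * (|γ| * τ + 1)) := by positivity
  refine ⟨τ + C₂ + C₃, by positivity, min 1 (1 / (2 * (|γ| * τ + 1))), lt_min one_pos hpos,
    min_le_left _ _, fun ε t hε hle ht => ?_⟩
  have h1 : ε ≤ 1 := hle.trans (min_le_left _ _)
  have h2 : ε ≤ 1 / (2 * (|γ| * τ + 1)) := hle.trans (min_le_right _ _)
  rw [le_div_iff₀ (by positivity)] at h2
  obtain ⟨h4, h5⟩ := inverseSlope_expansion γ hτ hε ht (by nlinarith)
  rw [← hC₃] at h5
  have ht2 : t ^ 2 ≤ τ ^ 2 := sq_le_sq' (by linarith [(abs_le.1 ht).1]) (abs_le.1 ht).2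
  have e3 : ε ^ 3 ≤ ε ^ 2 := pow_le_pow_of_le_one hε.le h1 (by norm_num)
  have e2 : ε ^ 2 ≤ ε := by nlinarith
  have h6 : |inverseSlope γ ε t - ε * t| ≤ (C₂ + C₃) * ε ^ 2 := by
    have h7 : |γ * ε ^ 2 * (1 + t ^ 2)| ≤ C₂ * ε ^ 2 := by
      rw [abs_mul, abs_mul, abs_of_nonneg (sq_nonneg ε),
        abs_of_nonneg (by positivity : 0 ≤ 1 + t ^ 2), hC₂, mul_right_comm]
      gcongr
    have h8 := abs_add_le (inverseSlope γ ε t - ε * t - γ * ε ^ 2 * (1 + t ^ 2))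
      (γ * ε ^ 2 * (1 + t ^ 2))
    rw [sub_add_cancel] at h8
    nlinarith [mul_le_mul_of_nonneg_left e3 hC₃0]
  have h7 : |inverseSlope γ ε t| ≤ (τ + C₂ + C₃) * ε := by
    have h8 := abs_add_le (inverseSlope γ ε t - ε * t) (ε * t)
    rw [sub_add_cancel, abs_mul ε, abs_of_pos hε] at h8
    nlinarith [mul_le_mul_of_nonneg_left ht hε.le,
      mul_le_mul_of_nonneg_left e2 (add_nonneg hC₂0 hC₃0)]
  refine ⟨by linarith, h5.trans ?_, h6.trans ?_, h7⟩
  · exact mul_le_mul_of_nonneg_right (by linarith) (by positivity)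
  · exact mul_le_mul_of_nonneg_right (by linarith) (by positivity)

/-- Here c is the inverse slope, D = cv the relative jump and H = h(D). Substituting c = εt + γε²(1
+ t²) + O(ε³) into D = 2c + 2γc² + O(c³) gives D = 2εt + 2γε²(1 + 2t²) + O(ε³) and D² = 4ε²t² +
O(ε³). -/
lemma jump_expansion {γ τ ε t c D C K M b₁ b₂ H : ℝ} (hε : 0 < ε) (hC : 0 ≤ C)
    (hK : 0 ≤ K) (hM : 0 ≤ M) (h1 : ε ≤ 1) (ht : |t| ≤ τ)
    (hc3 : |c - ε * t - γ * ε ^ 2 * (1 + t ^ 2)| ≤ C * ε ^ 3)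
    (hc2 : |c - ε * t| ≤ C * ε ^ 2) (hc1 : |c| ≤ C * ε) (hDc : |D| ≤ 3 * |c|)
    (hk : |D - 2 * c - 2 * γ * c ^ 2| ≤ K * |c| ^ 3)
    (hH : |H - b₁ * D - b₂ * D ^ 2| ≤ M * |D| ^ 3) :
    |H - 2 * ε * b₁ * t - ε ^ 2 * (2 * γ * b₁ * (1 + 2 * t ^ 2) + 4 * b₂ * t ^ 2)|
      ≤ (M * (3 * C) ^ 3 + |b₁| * (K * C ^ 3 + 2 * C + 2 * |γ| * (C * (C + τ)))
        + |b₂| * ((K * C ^ 3 + 2 * |γ| * C ^ 2 + 2 * C) * (3 * C + 2 * τ))) * ε ^ 3 := by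
  have e3 : ε ^ 3 ≤ ε ^ 2 := pow_le_pow_of_le_one hε.le h1 (by norm_num)
  have hεt : |ε * t| ≤ τ * ε := by
    rw [abs_mul, abs_of_pos hε, mul_comm]
    exact mul_le_mul_of_nonneg_right ht hε.le
  have hD1 : |D| ≤ 3 * C * ε := by linarith
  have hc3' : |c| ^ 3 ≤ (C * ε) ^ 3 := pow_le_pow_left₀ (abs_nonneg _) hc1 3
  have hc2' : |c| ^ 2 ≤ (C * ε) ^ 2 := pow_le_pow_left₀ (abs_nonneg _) hc1 2
  have hk' : |D - 2 * c - 2 * γ * c ^ 2| ≤ K * (C * ε) ^ 3 :=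
    hk.trans (mul_le_mul_of_nonneg_left hc3' hK)
  have hD3 : |D - 2 * ε * t - 2 * γ * ε ^ 2 * (1 + 2 * t ^ 2)|
      ≤ (K * C ^ 3 + 2 * C + 2 * |γ| * (C * (C + τ))) * ε ^ 3 := by
    have a1 : |2 * (c - ε * t - γ * ε ^ 2 * (1 + t ^ 2))| ≤ 2 * (C * ε ^ 3) := by
      rw [abs_mul, abs_two]
      exact mul_le_mul_of_nonneg_left hc3 two_pos.le
    have a2 : |2 * γ * ((c - ε * t) * (c + ε * t))|
        ≤ 2 * |γ| * ((C * ε ^ 2) * (C * ε + τ * ε)) := by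
      rw [abs_mul, abs_mul 2, abs_two, abs_mul (c - ε * t)]
      exact mul_le_mul_of_nonneg_left (mul_le_mul hc2
        ((abs_add_le _ _).trans (add_le_add hc1 hεt)) (abs_nonneg _) (by positivity))
        (by positivity)
    have a3 := abs_add_three (D - 2 * c - 2 * γ * c ^ 2)
      (2 * (c - ε * t - γ * ε ^ 2 * (1 + t ^ 2))) (2 * γ * ((c - ε * t) * (c + ε * t)))
    rw [show D - 2 * ε * t - 2 * γ * ε ^ 2 * (1 + 2 * t ^ 2) = (D - 2 * c - 2 * γ * c ^ 2)
      + 2 * (c - ε * t - γ * ε ^ 2 * (1 + t ^ 2)) + 2 * γ * ((c - ε * t) * (c + ε * t)) by ring]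
    linarith
  have hD2 : |D - 2 * ε * t| ≤ (K * C ^ 3 + 2 * |γ| * C ^ 2 + 2 * C) * ε ^ 2 := by
    have a1 : |2 * (c - ε * t)| ≤ 2 * (C * ε ^ 2) := by
      rw [abs_mul, abs_two]
      exact mul_le_mul_of_nonneg_left hc2 two_pos.le
    have a2 : |2 * γ * c ^ 2| ≤ 2 * |γ| * (C * ε) ^ 2 := by
      rw [abs_mul, abs_mul, abs_two, abs_pow]
      exact mul_le_mul_of_nonneg_left hc2' (by positivity)
    have a3 := abs_add_three (D - 2 * c - 2 * γ * c ^ 2) (2 * (c - ε * t)) (2 * γ * c ^ 2)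
    rw [show D - 2 * ε * t = (D - 2 * c - 2 * γ * c ^ 2) + 2 * (c - ε * t) + 2 * γ * c ^ 2 by ring]
    have a4 : K * (C * ε) ^ 3 ≤ K * C ^ 3 * ε ^ 2 := by
      rw [mul_pow, ← mul_assoc]
      exact mul_le_mul_of_nonneg_left e3 (by positivity)
    linarith
  have hDsq : |D ^ 2 - 4 * ε ^ 2 * t ^ 2|
      ≤ (K * C ^ 3 + 2 * |γ| * C ^ 2 + 2 * C) * (3 * C + 2 * τ) * ε ^ 3 := by
    have a1 : |D + 2 * (ε * t)| ≤ 3 * C * ε + 2 * (τ * ε) := by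
      refine (abs_add_le _ _).trans (add_le_add hD1 ?_)
      rw [abs_mul, abs_two]
      exact mul_le_mul_of_nonneg_left hεt two_pos.le
    have a2 := mul_le_mul hD2 a1 (abs_nonneg _) (by positivity)
    rw [← abs_mul] at a2
    rw [show D ^ 2 - 4 * ε ^ 2 * t ^ 2 = (D - 2 * ε * t) * (D + 2 * (ε * t)) by ring]
    linarith
  have hD3' : |D| ^ 3 ≤ (3 * C * ε) ^ 3 := pow_le_pow_left₀ (abs_nonneg _) hD1 3
  have b1' := mul_le_mul_of_nonneg_left hD3 (abs_nonneg b₁)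
  have b2' := mul_le_mul_of_nonneg_left hDsq (abs_nonneg b₂)
  have b3' := mul_le_mul_of_nonneg_left hD3' hM
  rw [← abs_mul] at b1' b2'
  have b4' := abs_add_three (H - b₁ * D - b₂ * D ^ 2)
    (b₁ * (D - 2 * ε * t - 2 * γ * ε ^ 2 * (1 + 2 * t ^ 2)))
    (b₂ * (D ^ 2 - 4 * ε ^ 2 * t ^ 2))
  rw [show H - 2 * ε * b₁ * t - ε ^ 2 * (2 * γ * b₁ * (1 + 2 * t ^ 2) + 4 * b₂ * t ^ 2)
    = (H - b₁ * D - b₂ * D ^ 2) + b₁ * (D - 2 * ε * t - 2 * γ * ε ^ 2 * (1 + 2 * t ^ 2))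
      + b₂ * (D ^ 2 - 4 * ε ^ 2 * t ^ 2) by ring]
  linarith

/-- The root `v` and the threshold `ε₀` are chosen before `h`, because one and the same chain is
tested against several functions; only the error constant depends on `h`. -/
lemma exists_jump_expansion (γ : ℝ) {τ : ℝ} (hτ : 0 ≤ τ) :
    ∃ v : ℝ → ℝ, Measurable v ∧ ∃ ε₀ : ℝ, 0 < ε₀ ∧
      (∀ ε t, 0 < ε → ε ≤ ε₀ → |t| ≤ τ →
        0 < 1 - γ * ε * t ∧ IsFlight γ (inverseSlope γ ε t) (v (inverseSlope γ ε t))) ∧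
      ∀ h b₁ b₂, HasQuadraticExpansion h b₁ b₂ → ∃ K : ℝ, 0 ≤ K ∧
        ∀ ε t, 0 < ε → ε ≤ ε₀ → |t| ≤ τ →
          |h (inverseSlope γ ε t * v (inverseSlope γ ε t)) - 2 * ε * b₁ * t
            - ε ^ 2 * (2 * γ * b₁ * (1 + 2 * t ^ 2) + 4 * b₂ * t ^ 2)| ≤ K * ε ^ 3 := by
  obtain ⟨v, hv, c₀, hc₀, hfl, K, hK0, hK⟩ := exists_flight γ
  obtain ⟨C, hC0, ε₁, hε₁, hε₁1, hC⟩ := exists_inverseSlope_bounds γ hτ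
  have hcc : ∀ ε t, 0 < ε → ε ≤ min ε₁ (c₀ / (C + 1)) → |t| ≤ τ →
      |inverseSlope γ ε t| ≤ c₀ := fun ε t hε hle ht => by
    have h3 : ε ≤ c₀ / (C + 1) := hle.trans (min_le_right _ _)
    rw [le_div_iff₀ (by positivity)] at h3
    linarith [(hC ε t hε (hle.trans (min_le_left _ _)) ht).2.2.2]
  refine ⟨v, hv, min ε₁ (c₀ / (C + 1)), lt_min hε₁ (by positivity), fun ε t hε hle ht =>
    ⟨(hC ε t hε (hle.trans (min_le_left _ _)) ht).1, hfl _ (hcc ε t hε hle ht)⟩, ?_⟩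
  rintro h b₁ b₂ ⟨M, hM0, hM⟩
  refine ⟨M * (3 * C) ^ 3 + |b₁| * (K * C ^ 3 + 2 * C + 2 * |γ| * (C * (C + τ)))
    + |b₂| * ((K * C ^ 3 + 2 * |γ| * C ^ 2 + 2 * C) * (3 * C + 2 * τ)), by positivity,
    fun ε t hε hle ht => ?_⟩
  · have hle' := hle.trans (min_le_left _ _)
    obtain ⟨-, hc3, hc2, hc1⟩ := hC ε t hε hle' ht
    have hf := hfl _ (hcc ε t hε hle ht)
    refine jump_expansion hε hC0 hK0 hM0 (hle'.trans hε₁1) ht hc3 hc2 hc1 ?_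
      (hK _ (hcc ε t hε hle ht)) (hM _ hf.2.2.1)
    rw [abs_mul, abs_of_pos hf.1, mul_comm]
    exact mul_le_mul_of_nonneg_right hf.2.1 (abs_nonneg _)

/-! ### Recurrence criteria for a killed chain on the line -/

open Filter Topology

/-- The Markov chain on `ℝ` with transitions `x ↦ F x a`, started at `x₀` and driven by the
angles `α 0, α 1, …`. -/
def chain {Ω : Type*} (F : ℝ → ℝ → ℝ) (x₀ : ℝ) (α : ℕ → Ω → ℝ) : ℕ → Ω → ℝ
  | 0, _ => x₀
  | n + 1, ω => F (chain F x₀ α n ω) (α n ω)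

/-- A transition map that is absorbed on `x ≤ B` and otherwise changes `x` at most by a
factor `2`. -/
structure IsKilledMap (F : ℝ → ℝ → ℝ) (B : ℝ) : Prop where
  measurable : Measurable (Function.uncurry F)
  pos : 0 < B
  absorbed : ∀ x a, x ≤ B → F x a = x
  half_le : ∀ x a, B < x → x / 2 ≤ F x a
  le_double : ∀ x a, B < x → F x a ≤ 2 * x

section Chain

variable {Ω : Type*} {F : ℝ → ℝ → ℝ} {B x₀ : ℝ} {α : ℕ → Ω → ℝ}

lemma IsKilledMap.half_le_chain (hF : IsKilledMap F B) (hx : B < x₀) (n : ℕ) (ω : Ω) :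
    B / 2 ≤ chain F x₀ α n ω := by
  induction n with
  | zero => simp only [chain]; linarith [hF.pos]
  | succ n ih =>
    rw [chain]
    rcases le_or_gt (chain F x₀ α n ω) B with h | h
    · rwa [hF.absorbed _ _ h]
    · linarith [hF.half_le _ (α n ω) h]

lemma IsKilledMap.chain_le (hF : IsKilledMap F B) (hx : B < x₀) (n : ℕ) (ω : Ω) :
    chain F x₀ α n ω ≤ 2 ^ n * x₀ := by
  induction n with
  | zero => simp [chain]
  | succ n ih =>
    rw [chain]
    have h0 : 0 < 2 ^ n * x₀ := mul_pos (by positivity) (hF.pos.trans hx)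
    rw [pow_succ]
    rcases le_or_gt (chain F x₀ α n ω) B with h | h
    · rw [hF.absorbed _ _ h]
      linarith
    · linarith [hF.le_double _ (α n ω) h]

lemma IsKilledMap.survival_antitone (hF : IsKilledMap F B) {m n : ℕ} (hmn : m ≤ n) {ω : Ω}
    (h : B < chain F x₀ α n ω) : B < chain F x₀ α m ω := by
  induction n, hmn using Nat.le_induction with
  | base => exact h
  | succ n _ ih =>
    refine ih ?_
    by_contra! h'
    rw [chain, hF.absorbed _ _ h'] at h
    exact absurd h' (not_le.2 h)

lemma IsKilledMap.measurable_chain_iSup (hF : IsKilledMap F B) (n : ℕ) :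
    Measurable[⨆ i ∈ Set.Iio n, MeasurableSpace.comap (α i) inferInstance]
      (chain F x₀ α n) := by
  induction n with
  | zero => exact @measurable_const _ _ _ (_) _
  | succ n ih =>
    have h1 : (⨆ i ∈ Set.Iio n, MeasurableSpace.comap (α i) inferInstance) ≤
        ⨆ i ∈ Set.Iio (n + 1), MeasurableSpace.comap (α i) inferInstance :=
      biSup_mono fun i hi => Set.mem_Iio.2 ((Set.mem_Iio.1 hi).trans n.lt_succ_self)
    have h2 : MeasurableSpace.comap (α n) inferInstance ≤
        ⨆ i ∈ Set.Iio (n + 1), MeasurableSpace.comap (α i) inferInstance :=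
      le_biSup (fun i => MeasurableSpace.comap (α i) inferInstance)
        (Set.mem_Iio.2 n.lt_succ_self)
    exact hF.measurable.comp (@Measurable.prodMk _ _ _ _ _ (_) _ _ (ih.mono h1 le_rfl)
      ((comap_measurable (α n)).mono h2 le_rfl))

variable [MeasurableSpace Ω]

lemma IsKilledMap.measurable_chain (hF : IsKilledMap F B) (hα : ∀ k, Measurable (α k)) (n : ℕ) :
    Measurable (chain F x₀ α n) :=
  (hF.measurable_chain_iSup n).mono (iSup₂_le fun i _ => (hα i).comap_le) le_rfl

variable {P : Measure Ω} {ν : Measure ℝ}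

/-- The states up to time k are functions of the angles with index below k. -/
lemma IsKilledMap.indepFun_chain (hF : IsKilledMap F B) (hα : ∀ k, Measurable (α k))
    (hi : iIndepFun α P) {j k : ℕ} (hjk : j ≤ k) :
    IndepFun (fun ω => (chain F x₀ α j ω, chain F x₀ α k ω)) (α k) P := by
  rw [IndepFun_iff_Indep]
  rw [iIndepFun_iff_iIndep] at hi
  have h := indep_iSup_of_disjoint (fun i => (hα i).comap_le) hi
    (S := Set.Iio k) (T := {k}) (by simp)
  refine indep_of_indep_of_le h ?_ ?_
  · have h1 : (⨆ i ∈ Set.Iio j, MeasurableSpace.comap (α i) inferInstance) ≤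
        ⨆ i ∈ Set.Iio k, MeasurableSpace.comap (α i) inferInstance :=
      biSup_mono fun i hi => Set.mem_Iio.2 ((Set.mem_Iio.1 hi).trans_le hjk)
    exact (@Measurable.prodMk _ _ _ _ _ (_) _ _ ((hF.measurable_chain_iSup j).mono h1 le_rfl)
      (hF.measurable_chain_iSup k)).comap_le
  · simp

variable [IsProbabilityMeasure P]

/-- The Markov property, in the form of a one-step drift inequality. -/
lemma IsKilledMap.integral_chain_succ_le (hF : IsKilledMap F B) (hx : B < x₀)
    (hα : ∀ k, Measurable (α k)) (hi : iIndepFun α P) (hν : ∀ k, P.map (α k) = ν)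
    {j k : ℕ} (hjk : j ≤ k) {Φ : ℝ → ℝ → ℝ} (hΦ : Measurable (Function.uncurry Φ)) {M : ℝ}
    (hM : ∀ y z, B / 2 ≤ y → y ≤ 2 ^ (k + 1) * x₀ → B / 2 ≤ z → z ≤ 2 ^ (k + 1) * x₀ →
      |Φ y z| ≤ M)
    {e : ℝ → ℝ} (he : Measurable e) {M' : ℝ} (heM : ∀ x, |e x| ≤ M')
    (hdrift : ∀ y x, B < x → ∫ a, Φ y (F x a) ∂ν ≤ Φ y x - e x) :
    ∫ ω, Φ (chain F x₀ α j ω) (chain F x₀ α (k + 1) ω) ∂P ≤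
      ∫ ω, Φ (chain F x₀ α j ω) (chain F x₀ α k ω) ∂P
        - ∫ ω, {ω | B < chain F x₀ α k ω}.indicator (fun ω => e (chain F x₀ α k ω)) ω ∂P := by
  have hprob : IsProbabilityMeasure ν := hν 0 ▸ Measure.isProbabilityMeasure_map (hα 0).aemeasurable
  have hmj := hF.measurable_chain (x₀ := x₀) hα j
  have hmk := hF.measurable_chain (x₀ := x₀) hα k
  have hmk1 := hF.measurable_chain (x₀ := x₀) hα (k + 1)
  have hx0 : 0 < x₀ := hF.pos.trans hx
  have hle : ∀ i ≤ k + 1, ∀ ω, chain F x₀ α i ω ≤ 2 ^ (k + 1) * x₀ := fun i hik ω =>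
    (hF.chain_le hx i ω).trans
      (mul_le_mul_of_nonneg_right (pow_le_pow_right₀ (by norm_num) hik) hx0.le)
  have hint : ∀ i ≤ k + 1, Integrable (fun ω => Φ (chain F x₀ α j ω) (chain F x₀ α i ω)) P :=
    fun i hik => Integrable.of_bound
      (hΦ.comp (hmj.prodMk (hF.measurable_chain hα i))).aestronglyMeasurable M
      (Eventually.of_forall fun ω => hM _ _ (hF.half_le_chain hx j ω) (hle j (by omega) ω)
        (hF.half_le_chain hx i ω) (hle i hik ω))
  have hW : Measurable fun ω => (chain F x₀ α j ω, chain F x₀ α k ω) := hmj.prodMk hmk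
  have hmap := (hF.indepFun_chain (x₀ := x₀) hα hi hjk).map_prod_eq_prod_map_map hW.aemeasurable
    (hα k).aemeasurable
  rw [hν k] at hmap
  have hΨ : Measurable fun q : (ℝ × ℝ) × ℝ => Φ q.1.1 (F q.1.2 q.2) :=
    hΦ.comp (measurable_fst.fst.prodMk (hF.measurable.comp (measurable_fst.snd.prodMk
      measurable_snd)))
  have hWα : Measurable fun ω => ((chain F x₀ α j ω, chain F x₀ α k ω), α k ω) := hW.prodMk (hα k)
  have hintΨ : Integrable (fun q : (ℝ × ℝ) × ℝ => Φ q.1.1 (F q.1.2 q.2))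
      ((P.map fun ω => (chain F x₀ α j ω, chain F x₀ α k ω)).prod ν) := by
    rw [← hmap, integrable_map_measure hΨ.aestronglyMeasurable hWα.aemeasurable]
    exact hint (k + 1) le_rfl
  have hmI : StronglyMeasurable fun q : ℝ × ℝ => ∫ a, Φ q.1 (F q.2 a) ∂ν :=
    hΨ.stronglyMeasurable.integral_prod_right'
  have h1 : ∫ ω, Φ (chain F x₀ α j ω) (chain F x₀ α (k + 1) ω) ∂P
      = ∫ ω, ∫ a, Φ (chain F x₀ α j ω) (F (chain F x₀ α k ω) a) ∂ν ∂P := by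
    calc _ = ∫ q, Φ q.1.1 (F q.1.2 q.2)
          ∂(P.map fun ω => ((chain F x₀ α j ω, chain F x₀ α k ω), α k ω)) :=
          (integral_map hWα.aemeasurable hΨ.aestronglyMeasurable).symm
      _ = _ := by
          rw [hmap, integral_prod _ hintΨ, integral_map hW.aemeasurable hmI.aestronglyMeasurable]
  have hset : MeasurableSet {ω | B < chain F x₀ α k ω} := measurableSet_lt measurable_const hmk
  have hinte : Integrable ({ω | B < chain F x₀ α k ω}.indicator
      fun ω => e (chain F x₀ α k ω)) P :=
    (Integrable.of_bound (he.comp hmk).aestronglyMeasurable M'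
      (Eventually.of_forall fun ω => heM _)).indicator hset
  rw [h1, ← integral_sub (hint k (by omega)) hinte]
  refine integral_mono ?_ ((hint k (by omega)).sub hinte) fun ω => ?_
  · exact (integrable_map_measure hmI.aestronglyMeasurable hW.aemeasurable).1
      hintΨ.integral_prod_left
  -- At or below B the chain is frozen, so the step changes nothing and the indicator term is zero.
  · by_cases h : B < chain F x₀ α k ω
    · simp only [Set.indicator, Set.mem_ofPred_eq, h, if_true]
      exact hdrift _ _ h
    · simp only [Set.indicator, Set.mem_ofPred_eq, h, if_false, sub_zero]
      simp only [hF.absorbed _ _ (not_lt.1 h), integral_const, probReal_univ, one_smul, le_refl]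

/-- Summing the drift of f bounds κ Σ P[B < X_n ≤ R] by f(x₀), so the mass in (B, R] tends to 0.
Markov's inequality bounds the mass beyond R by f(x₀)/f(R), which is small for large R. -/
lemma IsKilledMap.tendsto_survival (hF : IsKilledMap F B) (hx : B < x₀)
    (hα : ∀ k, Measurable (α k)) (hi : iIndepFun α P) (hν : ∀ k, P.map (α k) = ν)
    {f : ℝ → ℝ} (hf : Measurable f) (hf0 : ∀ x, B / 2 ≤ x → 0 ≤ f x)
    (hmono : MonotoneOn f (Set.Ici (B / 2))) (htop : Tendsto f atTop atTop)
    (hdrift : ∀ R, ∃ κ > 0, ∀ x, B < x →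
      ∫ a, f (F x a) ∂ν ≤ f x - if x ≤ R then κ else 0) :
    Tendsto (fun n => P.real {ω | B < chain F x₀ α n ω}) atTop (𝓝 0) := by
  have hm := fun n => hF.measurable_chain (x₀ := x₀) hα n
  have hx0 : 0 < x₀ := hF.pos.trans hx
  have hstep : ∀ R κ, (∀ x, B < x → ∫ a, f (F x a) ∂ν ≤ f x - if x ≤ R then κ else 0) → ∀ n,
      ∫ ω, f (chain F x₀ α (n + 1) ω) ∂P ≤ ∫ ω, f (chain F x₀ α n ω) ∂P
        - κ * P.real {ω | B < chain F x₀ α n ω ∧ chain F x₀ α n ω ≤ R} := by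
    intro R κ hκ n
    have := hF.integral_chain_succ_le hx hα hi hν (le_refl n) (Φ := fun _ x => f x)
      (hf.comp measurable_snd) (M := f (2 ^ (n + 1) * x₀))
      (fun y z _ _ h1 h2 => by
        rw [abs_of_nonneg (hf0 z h1)]
        exact hmono h1 (h1.trans h2) h2)
      (e := fun x => if x ≤ R then κ else 0)
      (Measurable.ite measurableSet_Iic measurable_const measurable_const) (M' := |κ|)
      (fun x => by split_ifs <;> simp) (fun _ => hκ)
    have hset : MeasurableSet {ω | B < chain F x₀ α n ω ∧ chain F x₀ α n ω ≤ R} :=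
      (measurableSet_lt measurable_const (hm n)).inter (measurableSet_le (hm n) measurable_const)
    have e : ∫ ω, {ω | B < chain F x₀ α n ω}.indicator
        (fun ω => if chain F x₀ α n ω ≤ R then κ else 0) ω ∂P
        = κ * P.real {ω | B < chain F x₀ α n ω ∧ chain F x₀ α n ω ≤ R} := by
      rw [mul_comm, ← smul_eq_mul, ← integral_indicator_const κ hset]
      congr 1
      ext ω
      by_cases h1 : B < chain F x₀ α n ω <;> by_cases h2 : chain F x₀ α n ω ≤ R <;>
        simp [Set.indicator, h1, h2]
    rw [e] at this
    exact this
  have hsum : ∀ R κ, (∀ x, B < x → ∫ a, f (F x a) ∂ν ≤ f x - if x ≤ R then κ else 0) → ∀ n,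
      ∫ ω, f (chain F x₀ α n ω) ∂P + ∑ i ∈ Finset.range n,
        κ * P.real {ω | B < chain F x₀ α i ω ∧ chain F x₀ α i ω ≤ R} ≤ f x₀ := by
    intro R κ hκ n
    induction n with
    | zero => simp [chain]
    | succ n ih =>
      rw [Finset.sum_range_succ]
      linarith [hstep R κ hκ n]
  have hE0 : ∀ n, 0 ≤ ∫ ω, f (chain F x₀ α n ω) ∂P := fun n =>
    integral_nonneg fun ω => hf0 _ (hF.half_le_chain hx n ω)
  rw [Metric.tendsto_atTop]
  intro η hη
  -- The summand 1 makes f(R) positive and the bound f(x₀)/f(R) < η/2 strict.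
  obtain ⟨R, hRB, hR⟩ : ∃ R, B < R ∧ 2 * (f x₀ + 1) / η ≤ f R :=
    ((eventually_gt_atTop B).and (htop.eventually_ge_atTop _)).exists
  have hfx0 : 0 ≤ f x₀ := hf0 _ (by linarith [hF.pos])
  obtain ⟨κ, hκ0, hκ⟩ := hdrift R
  have hs : Summable fun n => κ * P.real {ω | B < chain F x₀ α n ω ∧ chain F x₀ α n ω ≤ R} :=
    summable_of_sum_range_le (fun n => by positivity) (c := f x₀) fun n => by
      linarith [hsum R κ hκ n, hE0 n]
  have ht := hs.tendsto_atTop_zero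
  rw [Metric.tendsto_atTop] at ht
  obtain ⟨N, hN⟩ := ht (κ * (η / 2)) (by positivity)
  refine ⟨N, fun n hn => ?_⟩
  have h1 := hN n hn
  rw [Real.dist_eq, sub_zero, abs_of_nonneg (by positivity)] at h1 ⊢
  have h1' := lt_of_mul_lt_mul_left h1 hκ0.le
  have hfR : 0 < f R := lt_of_lt_of_le (by positivity) hR
  have hintf : Integrable (fun ω => f (chain F x₀ α n ω)) P :=
    Integrable.of_bound (hf.comp (hm n)).aestronglyMeasurable (f (2 ^ n * x₀))
      (Eventually.of_forall fun ω => by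
        have := hF.half_le_chain hx (α := α) n ω
        rw [Real.norm_eq_abs, abs_of_nonneg (hf0 _ this)]
        exact hmono this (this.trans (hF.chain_le hx n ω)) (hF.chain_le hx n ω))
  have h2 := mul_meas_ge_le_integral_of_nonneg
    (Eventually.of_forall fun ω => hf0 _ (hF.half_le_chain hx (α := α) n ω)) hintf (f R)
  have h3 : ∫ ω, f (chain F x₀ α n ω) ∂P ≤ f x₀ := by
    have := hsum R κ hκ n
    have h0 : 0 ≤ ∑ i ∈ Finset.range n,
        κ * P.real {ω | B < chain F x₀ α i ω ∧ chain F x₀ α i ω ≤ R} :=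
      Finset.sum_nonneg fun i _ => by positivity
    linarith
  have h4 : P.real {ω | f R ≤ f (chain F x₀ α n ω)} < η / 2 := by
    rw [div_le_iff₀ hη] at hR
    by_contra! hcon
    have := mul_le_mul_of_nonneg_left hcon hfR.le
    linarith
  calc P.real {ω | B < chain F x₀ α n ω}
      ≤ P.real ({ω | B < chain F x₀ α n ω ∧ chain F x₀ α n ω ≤ R} ∪
          {ω | f R ≤ f (chain F x₀ α n ω)}) := by
        refine measureReal_mono fun ω hω => ?_
        rcases le_or_gt (chain F x₀ α n ω) R with h | h
        · exact Or.inl ⟨hω, h⟩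
        · exact Or.inr (hmono (by simp only [Set.mem_Ici]; linarith [hF.pos])
            (hF.half_le_chain hx n ω) h.le)
    _ ≤ _ := measureReal_union_le _ _
    _ < η := by linarith

/-- Where the bump is positive, |z - u| ≤ u/2 ≤ z, so the cross term 8(z - u)E[D] is at most 8C
although z is unbounded; the square of the jump costs 4C². Elsewhere the bump is zero and cannot
decrease. -/
lemma le_integral_truncated_square [IsProbabilityMeasure ν] {D : ℝ → ℝ} {C u z : ℝ}
    (hDm : Measurable D) (hz : 0 < z) (hu : 0 ≤ u) (hD : ∀ᵐ a ∂ν, |D a| ≤ C)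
    (hd : |∫ a, D a ∂ν| ≤ C / z) :
    max 0 (u ^ 2 - 4 * (z - u) ^ 2) - (8 * C + 4 * C ^ 2)
      ≤ ∫ a, max 0 (u ^ 2 - 4 * (z + D a - u) ^ 2) ∂ν := by
  have hC : 0 ≤ C := by
    obtain ⟨a, ha⟩ := hD.exists
    exact (abs_nonneg _).trans ha
  have h0 : 0 ≤ ∫ a, max 0 (u ^ 2 - 4 * (z + D a - u) ^ 2) ∂ν :=
    integral_nonneg fun a => le_max_left _ _
  rcases le_or_gt (u ^ 2 - 4 * (z - u) ^ 2) 0 with h | h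
  · rw [max_eq_left h]
    nlinarith
  rw [max_eq_right h.le]
  have hDi : Integrable D ν := Integrable.of_bound hDm.aestronglyMeasurable C hD
  have hzu : |z - u| ≤ u / 2 := abs_le_of_sq_le_sq (by nlinarith) (by linarith)
  have huz : u / 2 ≤ z := by linarith [(abs_le.1 hzu).1]
  have h1 : |(z - u) * ∫ a, D a ∂ν| ≤ C := by
    rw [abs_mul]
    calc _ ≤ z * (C / z) := mul_le_mul (hzu.trans huz) hd (abs_nonneg _) hz.le
      _ = C := by field_simp
  have h2 : ∫ a, (u ^ 2 - 4 * (z - u) ^ 2 - 4 * C ^ 2 - 8 * (z - u) * D a) ∂ν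
      = u ^ 2 - 4 * (z - u) ^ 2 - 4 * C ^ 2 - 8 * ((z - u) * ∫ a, D a ∂ν) := by
    rw [integral_sub (integrable_const _) (hDi.const_mul _), integral_const_mul]
    simp
    ring
  have h3 : ∫ a, (u ^ 2 - 4 * (z - u) ^ 2 - 4 * C ^ 2 - 8 * (z - u) * D a) ∂ν
      ≤ ∫ a, max 0 (u ^ 2 - 4 * (z + D a - u) ^ 2) ∂ν := by
    refine integral_mono_ae ((integrable_const _).sub (hDi.const_mul _)) ?_ ?_
    · refine Integrable.of_bound (by fun_prop) (u ^ 2) (Eventually.of_forall fun a => ?_)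
      rw [Real.norm_eq_abs, abs_of_nonneg (le_max_left _ _)]
      exact max_le (sq_nonneg _) (by nlinarith [sq_nonneg (z + D a - u)])
    · filter_upwards [hD] with a ha
      refine le_max_of_le_right ?_
      have := sq_le_sq' (by linarith [(abs_le.1 ha).1]) (abs_le.1 ha).2
      nlinarith
  linarith [(abs_le.1 h1).2]

/-- Let p_i be the probability of survival at time i. Conditionally on X_n = y with Y(y) ≥ 2Y(B),
the bump (Y(y)² - 4(Y(·) - Y(y))²)⁺ starts at Y(y)², loses at most 8C + 4C² per step in mean, and is
zero once the chain is killed. Hence the mean remaining lifetime is at least Y(y)²/(8C + 4C²). If Σ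
p_i converges, the mean of Y(X_n)² over such surviving states is bounded by a tail of the series. As
f ≤ Y², the submartingale property then yields f(x₀) ≤ f(B) in the limit, against strict
monotonicity. -/
lemma IsKilledMap.not_summable_survival (hF : IsKilledMap F B) (hx : B < x₀)
    (hα : ∀ k, Measurable (α k)) (hi : iIndepFun α P) (hν : ∀ k, P.map (α k) = ν)
    {Y f : ℝ → ℝ} (hY : Measurable Y) (hf : Measurable f) (hYmono : MonotoneOn Y (Set.Ici (B / 2)))
    (hYpos : ∀ x, B / 2 ≤ x → 0 < Y x) {C : ℝ}
    (hYjump : ∀ x, B < x → ∀ᵐ a ∂ν, |Y (F x a) - Y x| ≤ C)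
    (hYdrift : ∀ x, B < x → |∫ a, (Y (F x a) - Y x) ∂ν| ≤ C / Y x)
    (hf0 : ∀ x, B / 2 ≤ x → 0 ≤ f x) (hfY : ∀ x, B / 2 ≤ x → f x ≤ Y x ^ 2)
    (hfmono : StrictMonoOn f (Set.Ici (B / 2)))
    (hfdrift : ∀ x, B < x → f x ≤ ∫ a, f (F x a) ∂ν) :
    ¬ Summable fun n => P.real {ω | B < chain F x₀ α n ω} := by
  intro hs
  have hprob : IsProbabilityMeasure ν := hν 0 ▸ Measure.isProbabilityMeasure_map (hα 0).aemeasurable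
  have hm := fun n => hF.measurable_chain (x₀ := x₀) hα n
  have hset : ∀ n, MeasurableSet {ω | B < chain F x₀ α n ω} := fun n =>
    measurableSet_lt measurable_const (hm n)
  have hBpos := hF.pos
  have hx0 : 0 < x₀ := hBpos.trans hx
  have hlow := fun n ω => hF.half_le_chain (α := α) hx n ω
  have hup := fun n ω => hF.chain_le (α := α) hx n ω
  have hBB : B ∈ Set.Ici (B / 2) := by simp only [Set.mem_Ici]; linarith
  -- The cutoff 2Y(B) ≤ Y(y) places killed states at distance at least Y(y)/2 from Y(y), outside the
  -- support of the bump.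
  set H : ℝ → ℝ → ℝ := fun y z =>
    if 2 * Y B ≤ Y y then max 0 (Y y ^ 2 - 4 * (Y z - Y y) ^ 2) else 0 with hH
  have hHm : Measurable (Function.uncurry H) := by
    refine Measurable.ite (measurableSet_le measurable_const (hY.comp measurable_fst)) ?_
      measurable_const
    fun_prop
  have hH0 : ∀ y z, 0 ≤ H y z := fun y z => by
    simp only [hH]; split_ifs
    · exact le_max_left _ _
    · exact le_rfl
  have hHle : ∀ y z, H y z ≤ Y y ^ 2 := fun y z => by
    simp only [hH]; split_ifs
    · exact max_le (sq_nonneg _) (by nlinarith [sq_nonneg (Y z - Y y)])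
    · exact sq_nonneg _
  have hHB : ∀ y z, B / 2 ≤ z → z ≤ B → H y z = 0 := fun y z hz hzB => by
    simp only [hH]; split_ifs with h
    · refine max_eq_left ?_
      have h1 := hYmono hz hBB hzB
      have h2 := hYpos B hBB
      nlinarith
    · rfl
  have hHself : ∀ y, B / 2 ≤ y → f y ≤ 4 * Y B ^ 2 + H y y := fun y hy => by
    simp only [hH]; split_ifs with h
    · rw [sub_self]
      norm_num
      nlinarith [hfY y hy, le_max_right 0 (Y y ^ 2), sq_nonneg (Y B)]
    · have := hYpos y hy
      nlinarith [hfY y hy, hYpos B hBB]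
  have hHdrift : ∀ y x, B < x → H y x - (8 * C + 4 * C ^ 2) ≤ ∫ a, H y (F x a) ∂ν := by
    intro y x hBx
    have hFx : Measurable (F x) := hF.measurable.of_uncurry_left
    simp only [hH]
    split_ifs with h
    · have := le_integral_truncated_square (ν := ν) (D := fun a => Y (F x a) - Y x) (C := C)
        (u := Y y) (z := Y x) ((hY.comp hFx).sub_const _) (hYpos x (by linarith))
        (by linarith [hYpos B hBB]) (hYjump x hBx) (hYdrift x hBx)
      simpa using this
    · obtain ⟨a, ha⟩ := (hYjump x hBx).exists
      have hC := (abs_nonneg _).trans ha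
      simp only [integral_zero]
      nlinarith
  set p : ℕ → ℝ := fun n => P.real {ω | B < chain F x₀ α n ω} with hp
  have hHstep : ∀ n k, ∫ ω, H (chain F x₀ α n ω) (chain F x₀ α (n + k) ω) ∂P
      - (8 * C + 4 * C ^ 2) * p (n + k)
      ≤ ∫ ω, H (chain F x₀ α n ω) (chain F x₀ α (n + k + 1) ω) ∂P := by
    intro n k
    have := hF.integral_chain_succ_le hx hα hi hν (Nat.le_add_right n k) (Φ := fun y z => -H y z)
      hHm.neg (M := Y (2 ^ (n + k + 1) * x₀) ^ 2)
      (fun y z h1 h2 _ _ => by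
        rw [abs_neg, abs_of_nonneg (hH0 y z)]
        exact (hHle y z).trans (pow_le_pow_left₀ (hYpos y h1).le (hYmono h1 (h1.trans h2) h2) 2))
      (e := fun _ => -(8 * C + 4 * C ^ 2)) measurable_const (M' := |-(8 * C + 4 * C ^ 2)|)
      (fun _ => le_rfl) (fun y x hBx => by
        rw [integral_neg]
        linarith [hHdrift y x hBx])
    rw [integral_neg, integral_neg, integral_indicator_const _ (hset _), smul_eq_mul] at this
    simp only [hp]
    linarith
  have hHsum : ∀ n k, ∫ ω, H (chain F x₀ α n ω) (chain F x₀ α n ω) ∂P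
      - (8 * C + 4 * C ^ 2) * ∑ i ∈ Finset.range k, p (n + i)
      ≤ ∫ ω, H (chain F x₀ α n ω) (chain F x₀ α (n + k) ω) ∂P := by
    intro n k
    induction k with
    | zero => simp
    | succ k ih =>
      rw [Finset.sum_range_succ, ← add_assoc]
      linarith [hHstep n k]
  have hHup : ∀ n k, ∫ ω, H (chain F x₀ α n ω) (chain F x₀ α (n + k) ω) ∂P
      ≤ Y (2 ^ n * x₀) ^ 2 * p (n + k) := by
    intro n k
    rw [mul_comm, ← smul_eq_mul, ← integral_indicator_const _ (hset _)]
    refine integral_mono_of_nonneg (Eventually.of_forall fun ω => hH0 _ _)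
      ((integrable_const _).indicator (hset _)) (Eventually.of_forall fun ω => ?_)
    by_cases h : B < chain F x₀ α (n + k) ω
    · simp only [Set.indicator, Set.mem_ofPred_eq, h, if_true]
      exact (hHle _ _).trans (pow_le_pow_left₀ (hYpos _ (hlow n ω)).le
        (hYmono (hlow n ω) ((hlow n ω).trans (hup n ω)) (hup n ω)) 2)
    · simp only [Set.indicator, Set.mem_ofPred_eq, h, if_false]
      exact (hHB _ _ (hlow _ ω) (not_lt.1 h)).le
  have hp0 : Tendsto p atTop (𝓝 0) := hs.tendsto_atTop_zero
  have hHn : ∀ n, ∫ ω, H (chain F x₀ α n ω) (chain F x₀ α n ω) ∂P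
      ≤ (8 * C + 4 * C ^ 2) * ∑' i, p (i + n) := by
    intro n
    -- For fixed n the bump is bounded by Y(2^n x₀)² uniformly in k, so its mean at time n + k
    -- vanishes as k → ∞ together with p (n + k).
    have h1 : Tendsto (fun k => (8 * C + 4 * C ^ 2) * ∑ i ∈ Finset.range k, p (n + i)
        + Y (2 ^ n * x₀) ^ 2 * p (n + k)) atTop
        (𝓝 ((8 * C + 4 * C ^ 2) * ∑' i, p (n + i) + Y (2 ^ n * x₀) ^ 2 * 0)) := by
      have hsn : Summable fun i => p (n + i) := by
        simpa only [add_comm] using (summable_nat_add_iff n).2 hs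
      refine (hsn.hasSum.tendsto_sum_nat.const_mul _).add (Tendsto.const_mul _ ?_)
      simpa only [Function.comp_def, add_comm] using hp0.comp (tendsto_add_atTop_nat n)
    rw [mul_zero, add_zero] at h1
    simp only [add_comm _ n]
    exact ge_of_tendsto' h1 fun k => by linarith [hHsum n k, hHup n k]
  have hfE : ∀ n, f x₀ ≤ ∫ ω, f (chain F x₀ α n ω) ∂P := by
    intro n
    induction n with
    | zero => simp [chain]
    | succ n ih =>
      have := hF.integral_chain_succ_le hx hα hi hν (le_refl n) (Φ := fun _ z => -f z)
        (hf.comp measurable_snd).neg (M := f (2 ^ (n + 1) * x₀))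
        (fun y z _ _ h1 h2 => by
          rw [abs_neg, abs_of_nonneg (hf0 z h1)]
          exact hfmono.monotoneOn h1 (h1.trans h2) h2)
        (e := fun _ => 0) measurable_const (M' := 0) (by simp) (fun y x hBx => by
          rw [integral_neg]
          linarith [hfdrift x hBx])
      rw [integral_neg, integral_neg] at this
      simp only [Set.indicator_zero, integral_zero] at this
      linarith
  -- Killed states contribute at most f(B). Surviving states with Y < 2Y(B) contribute at most
  -- 4Y(B)² each, and the others are controlled by the bump.
  have hfn : ∀ n, f x₀ ≤ f B + 4 * Y B ^ 2 * p n + (8 * C + 4 * C ^ 2) * ∑' i, p (i + n) := by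
    intro n
    refine (hfE n).trans (le_trans ?_ (add_le_add_right (hHn n) _))
    have hHi : Integrable (fun ω => H (chain F x₀ α n ω) (chain F x₀ α n ω)) P :=
      Integrable.of_bound (hHm.comp ((hm n).prodMk (hm n))).aestronglyMeasurable
        (Y (2 ^ n * x₀) ^ 2) (Eventually.of_forall fun ω => by
          rw [Real.norm_eq_abs, abs_of_nonneg (hH0 _ _)]
          exact (hHle _ _).trans (pow_le_pow_left₀ (hYpos _ (hlow n ω)).le
            (hYmono (hlow n ω) ((hlow n ω).trans (hup n ω)) (hup n ω)) 2))
    have hIi : Integrable ({ω | B < chain F x₀ α n ω}.indicator fun _ => 4 * Y B ^ 2) P :=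
      (integrable_const _).indicator (hset n)
    have e : f B + 4 * Y B ^ 2 * p n + ∫ ω, H (chain F x₀ α n ω) (chain F x₀ α n ω) ∂P
        = ∫ ω, (f B + {ω | B < chain F x₀ α n ω}.indicator (fun _ => 4 * Y B ^ 2) ω
          + H (chain F x₀ α n ω) (chain F x₀ α n ω)) ∂P := by
      have hsum : Integrable (fun ω => f B + {ω | B < chain F x₀ α n ω}.indicator
          (fun _ => 4 * Y B ^ 2) ω) P := (integrable_const _).add hIi
      rw [integral_add hsum hHi, integral_add (integrable_const _) hIi,
        integral_indicator_const _ (hset n)]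
      simp [hp, mul_comm]
    rw [e]
    refine integral_mono_of_nonneg (Eventually.of_forall fun ω => hf0 _ (hlow n ω))
      (((integrable_const _).add hIi).add hHi) (Eventually.of_forall fun ω => ?_)
    by_cases h : B < chain F x₀ α n ω
    · simp only [Set.indicator, Set.mem_ofPred_eq, h, if_true]
      linarith [hHself _ (hlow n ω), hf0 B hBB]
    · simp only [Set.indicator, Set.mem_ofPred_eq, h, if_false]
      linarith [hfmono.monotoneOn (hlow n ω) hBB (not_lt.1 h),
        hH0 (chain F x₀ α n ω) (chain F x₀ α n ω)]
  have hlim : Tendsto (fun n => f B + 4 * Y B ^ 2 * p n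
      + (8 * C + 4 * C ^ 2) * ∑' i, p (i + n)) atTop
      (𝓝 (f B + 4 * Y B ^ 2 * 0 + (8 * C + 4 * C ^ 2) * 0)) :=
    ((hp0.const_mul _).const_add _).add ((tendsto_sum_nat_add p).const_mul _)
  rw [mul_zero, mul_zero, add_zero, add_zero] at hlim
  exact absurd (ge_of_tendsto' hlim hfn)
    (not_le.2 (hfmono hBB (by simp only [Set.mem_Ici]; linarith) hx))

end Chain

/-! ### Chords of the tube and the billiard step -/

section Geometry

variable {γ A : ℝ}

lemma isOpen_tube_rpow (hA : 0 < A) : IsOpen (tube (fun x => x ^ γ) A) := by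
  have hc : ContinuousOn (fun q : ℝ × ℝ => q.1 ^ γ - |q.2|) {q | A < q.1} := by
    intro q hq
    have : ContinuousAt (fun q : ℝ × ℝ => q.1 ^ γ) q :=
      ContinuousAt.rpow_const (by fun_prop) (Or.inl (hA.trans hq).ne')
    exact (this.sub (by fun_prop)).continuousWithinAt
  convert hc.isOpen_inter_preimage (isOpen_lt continuous_const continuous_fst)
    (isOpen_Ioi (a := (0 : ℝ))) using 1
  ext q
  simp [tube]

lemma abs_snd_eq_of_mem_frontier (hA : 0 < A) {q : ℝ × ℝ}
    (hq : q ∈ frontier (tube (fun x => x ^ γ) A)) (hAq : A < q.1) : |q.2| = q.1 ^ γ := by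
  rw [frontier, (isOpen_tube_rpow hA).interior_eq] at hq
  refine le_antisymm ?_ ?_
  · by_contra! h
    have hc : ContinuousOn (fun q : ℝ × ℝ => |q.2| - q.1 ^ γ) {q | A < q.1} := by
      intro q hq
      have : ContinuousAt (fun q : ℝ × ℝ => q.1 ^ γ) q :=
        ContinuousAt.rpow_const (by fun_prop) (Or.inl (hA.trans hq).ne')
      exact (ContinuousAt.sub (by fun_prop) this).continuousWithinAt
    have ho := hc.isOpen_inter_preimage (isOpen_lt continuous_const continuous_fst)
      (isOpen_Ioi (a := (0 : ℝ)))
    obtain ⟨r, ⟨-, hr1⟩, hr2⟩ := mem_closure_iff.1 hq.1 _ ho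
      ⟨hAq, by simpa using h⟩
    have h1 := hr2.2
    simp only [Set.mem_preimage, Set.mem_Ioi] at hr1
    linarith
  · by_contra! h
    exact hq.2 ⟨hAq, h⟩

lemma mem_frontier_of_abs_snd_eq (hA : 0 < A) {q : ℝ × ℝ} (hAq : A < q.1)
    (hq : |q.2| = q.1 ^ γ) : q ∈ frontier (tube (fun x => x ^ γ) A) := by
  rw [frontier, (isOpen_tube_rpow hA).interior_eq]
  refine ⟨?_, fun h => absurd h.2 (by simp [hq])⟩
  have ht : Tendsto (fun θ : ℝ => (q.1, θ * q.2)) (𝓝[<] 1) (𝓝 q) := by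
    have : ContinuousAt (fun θ : ℝ => (q.1, θ * q.2)) 1 := by fun_prop
    simpa [ContinuousAt] using this.tendsto.mono_left nhdsWithin_le_nhds
  refine mem_closure_of_tendsto ht ?_
  filter_upwards [Ioo_mem_nhdsLT (zero_lt_one (α := ℝ))] with θ hθ
  refine ⟨hAq, ?_⟩
  have hpos : 0 < q.1 ^ γ := Real.rpow_pos_of_pos (hA.trans hAq) _
  simp only [abs_mul, hq, abs_of_pos hθ.1]
  nlinarith [hθ.2]

/-- Since g' = γε, the direction is proportional to (t + γε, -σ(1 - γεt)), with σ the sign of the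
wall. The normalisation `μ` makes w the descent in units of g(x). -/
lemma direction_rpow {q : ℝ × ℝ} (hq : 0 < q.1) {a : ℝ} (ha : 0 < Real.cos a)
    (hs : 0 < 1 - γ * q.1 ^ (γ - 1) * Real.tan a) :
    ∃ μ > 0, ∀ w : ℝ, (q.1 ^ γ * w / μ) • direction (fun x => x ^ γ) q a
      = (q.1 * (inverseSlope γ (q.1 ^ (γ - 1)) (Real.tan a) * w),
          -(Real.sign q.2 * (q.1 ^ γ * w))) := by
  have hd : deriv (fun x : ℝ => x ^ γ) q.1 = γ * q.1 ^ (γ - 1) :=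
    (Real.hasDerivAt_rpow_const (Or.inl hq.ne')).deriv
  have hg : q.1 ^ γ = q.1 * q.1 ^ (γ - 1) := by
    rw [mul_comm, ← Real.rpow_add_one hq.ne', sub_add_cancel]
  have hk : 0 < (Real.sqrt (1 + (γ * q.1 ^ (γ - 1)) ^ 2))⁻¹ := by positivity
  unfold direction innerNormal rightTangent
  rw [hd, hg]
  generalize (Real.sqrt (1 + (γ * q.1 ^ (γ - 1)) ^ 2))⁻¹ = k at hk ⊢
  generalize q.1 ^ (γ - 1) = ε at hs ⊢
  have hsin : Real.sin a = Real.tan a * Real.cos a := (Real.tan_mul_cos ha.ne').symm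
  refine ⟨k * Real.cos a * (1 - γ * ε * Real.tan a), by positivity, fun w => ?_⟩
  rw [hsin, inverseSlope]
  have hne := hs.ne'
  generalize Real.tan a = t at hs hne ⊢
  generalize Real.cos a = y at ha ⊢
  ext
  · simp only [Prod.smul_mk, Prod.mk_add_mk, smul_eq_mul]
    rw [div_mul_eq_mul_div, div_mul_eq_mul_div, mul_div_assoc', div_eq_div_iff (by positivity) hne]
    ring
  · simp only [Prod.smul_mk, Prod.mk_add_mk, smul_eq_mul]
    rw [div_mul_eq_mul_div, div_eq_iff (by positivity)]
    ring

lemma step_rpow (hA : 0 < A) {q : ℝ × ℝ} (hq : q ∈ frontier (tube (fun x => x ^ γ) A))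
    (hAq : 2 * A < q.1) {a v : ℝ} (ha : 0 < Real.cos a)
    (hs : 0 < 1 - γ * q.1 ^ (γ - 1) * Real.tan a)
    (hv : IsFlight γ (inverseSlope γ (q.1 ^ (γ - 1)) (Real.tan a)) v) :
    ∃ r ∈ frontier (tube (fun x => x ^ γ) A), step (fun x => x ^ γ) A (some q) a = some r ∧
      r.1 = q.1 * (1 + inverseSlope γ (q.1 ^ (γ - 1)) (Real.tan a) * v) := by
  have hq0 : 0 < q.1 := by linarith
  have hgpos : 0 < q.1 ^ γ := Real.rpow_pos_of_pos hq0 _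
  have hq2 := abs_snd_eq_of_mem_frontier hA hq (by linarith)
  obtain ⟨μ, hμ, hdir⟩ := direction_rpow (γ := γ) hq0 ha hs
  generalize hc : inverseSlope γ (q.1 ^ (γ - 1)) (Real.tan a) = c at hv hdir ⊢
  obtain ⟨hv0, -, hcv, hve, hlt⟩ := hv
  have hσ : q.2 = Real.sign q.2 * q.1 ^ γ := by 
    rcases lt_trichotomy q.2 0 with h | h | h
    · rw [← hq2, Real.sign_of_neg h, abs_of_neg h]; ring
    · rw [h, Real.sign_zero, zero_mul]
    · rw [← hq2, Real.sign_of_pos h, abs_of_pos h, one_mul]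
  have hσ1 : |Real.sign q.2| = 1 := by
    have : q.2 ≠ 0 := fun h => by rw [h, abs_zero] at hq2; exact hgpos.ne hq2
    rcases Real.sign_apply_eq_of_ne_zero _ this with h | h <;> simp [h]
  generalize Real.sign q.2 = σ at hσ hσ1 hdir
  have hpt : ∀ w, q + (q.1 ^ γ * w / μ) • direction (fun x => x ^ γ) q a
      = (q.1 * (1 + c * w), σ * (q.1 ^ γ * (1 - w))) := fun w => by
    rw [hdir w]
    ext
    · simp only [Prod.fst_add]; ring
    · simp only [Prod.snd_add]; rw [hσ]; ring
  have hcw : ∀ w, 0 < w → w ≤ v → |c * w| ≤ 1 / 2 := fun w h0 h1 => by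
    refine le_trans ?_ hcv
    rw [abs_mul, abs_mul, abs_of_pos h0, abs_of_pos hv0]
    exact mul_le_mul_of_nonneg_left h1 (abs_nonneg _)
  have hAw : ∀ w, 0 < w → w ≤ v → A < q.1 * (1 + c * w) := fun w h0 h1 => by
    have := (abs_le.1 (hcw w h0 h1)).1
    nlinarith
  have hmul : ∀ w, 0 < w → w ≤ v → (q.1 * (1 + c * w)) ^ γ = q.1 ^ γ * (1 + c * w) ^ γ :=
    fun w h0 h1 => Real.mul_rpow hq0.le (by linarith [(abs_le.1 (hcw w h0 h1)).1])
  have hfr : (q.1 * (1 + c * v), σ * (q.1 ^ γ * (1 - v))) ∈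
      frontier (tube (fun x => x ^ γ) A) := by
    refine mem_frontier_of_abs_snd_eq hA (hAw v hv0 le_rfl) ?_
    simp only
    rw [hmul v hv0 le_rfl, abs_mul, hσ1, one_mul, abs_mul, abs_of_pos hgpos,
      show 1 - v = -(1 + c * v) ^ γ by linarith, abs_neg, abs_of_nonneg]
    exact Real.rpow_nonneg (by linarith [(abs_le.1 hcv).1]) _
  -- Before descent v the ray lies in the open tube, which is disjoint from its frontier.
  have hleast : IsLeast (hitParams (fun x => x ^ γ) A q a) (q.1 ^ γ * v / μ) := by
    refine ⟨⟨by positivity, by rw [hpt]; exact hfr⟩, ?_⟩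
    rintro l ⟨hl0, hl⟩
    by_contra! hlt'
    obtain ⟨w, rfl⟩ : ∃ w, l = q.1 ^ γ * w / μ := ⟨l * μ / q.1 ^ γ, by field_simp⟩
    have hw0 : 0 < w := by
      rw [lt_div_iff₀ hμ, zero_mul] at hl0
      exact pos_of_mul_pos_right hl0 hgpos.le
    have hwv : w < v := by
      rw [div_lt_div_iff_of_pos_right hμ] at hlt'
      exact lt_of_mul_lt_mul_left hlt' hgpos.le
    rw [hpt, frontier, (isOpen_tube_rpow hA).interior_eq] at hl
    refine hl.2 ⟨hAw w hw0 hwv.le, ?_⟩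
    simp only
    rw [hmul w hw0 hwv.le, abs_mul, hσ1, one_mul, abs_mul, abs_of_pos hgpos]
    exact mul_lt_mul_of_pos_left (hlt w hw0 hwv) hgpos
  have hfirst : firstHit (fun x => x ^ γ) A q a
      = (q.1 * (1 + c * v), σ * (q.1 ^ γ * (1 - v))) := by
    rw [firstHit, hleast.csInf_eq, hpt]
  refine ⟨_, hfr, ?_, rfl⟩
  simp only [step, hfirst]
  rw [if_pos ⟨_, hleast.1⟩, if_neg (hAw v hv0 le_rfl).ne']

end Geometry

/-! ### The stopped chain and the mean of its relative jump -/

/-- The relative change of the first coordinate between two collisions, at a point where the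
scaled width of the tube is `ε`. -/
noncomputable def relativeJump (γ : ℝ) (v : ℝ → ℝ) (ε a : ℝ) : ℝ :=
  inverseSlope γ ε (Real.tan a) * v (inverseSlope γ ε (Real.tan a))

open Classical in
/-- The motion of the first coordinate, stopped when it is at most `2A`. -/
noncomputable def stoppedMap (γ A a₀ : ℝ) (v : ℝ → ℝ) (x a : ℝ) : ℝ :=
  if 2 * A < x ∧ |a| < a₀ then x * (1 + relativeJump γ v (x ^ (γ - 1)) a) else x

/-- From boundary points beyond `2A`, the billiard moves the first coordinate by `stoppedMap`. -/
def StepFollows (γ A a₀ : ℝ) (v : ℝ → ℝ) : Prop :=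
  ∀ q ∈ frontier (tube (fun x => x ^ γ) A), 2 * A < q.1 → ∀ a, |a| < a₀ →
    ∃ r ∈ frontier (tube (fun x => x ^ γ) A), step (fun x => x ^ γ) A (some q) a = some r ∧
      r.1 = stoppedMap γ A a₀ v q.1 a

lemma measurable_tan : Measurable Real.tan := by
  rw [show Real.tan = fun a => Real.sin a / Real.cos a from
    funext fun a => Real.tan_eq_sin_div_cos a]
  fun_prop

lemma measurable_relativeJump (γ : ℝ) {v : ℝ → ℝ} (hv : Measurable v) :
    Measurable (Function.uncurry (relativeJump γ v)) := by
  have htan := measurable_tan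
  have hc : Measurable fun q : ℝ × ℝ => inverseSlope γ q.1 (Real.tan q.2) := by
    unfold inverseSlope
    fun_prop
  exact hc.mul (hv.comp hc)

/-- The half-lines [x, ∞) determine a finite measure, so the tail symmetry makes ν invariant under
negation. -/
lemma integral_eq_zero_of_odd {ν : Measure ℝ} [IsProbabilityMeasure ν]
    (hsymm : ∀ x : ℝ, ν (Set.Ici x) = ν (Set.Iic (-x))) {φ : ℝ → ℝ} (hodd : ∀ x, φ (-x) = -φ x) :
    ∫ a, φ a ∂ν = 0 := by
  have hmap : ν.map (fun x => -x) = ν := by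
    have := Measure.isProbabilityMeasure_map (μ := ν) (f := fun x : ℝ => -x) (by fun_prop)
    refine Measure.ext_of_Ici _ _ fun x => ?_
    rw [Measure.map_apply measurable_neg measurableSet_Ici, hsymm]
    congr 1
    ext y
    simp
  have h : ∫ a, φ a ∂ν = ∫ a, φ (-a) ∂ν := by
    conv_lhs => rw [← hmap]
    exact (MeasurableEquiv.neg ℝ).measurableEmbedding.integral_map φ
  simp only [hodd, integral_neg] at h
  linarith

/-- Integral asymptotics of the relative jump, for a reflection law `ν`. -/
lemma exists_drift_expansion {ν : Measure ℝ} [IsProbabilityMeasure ν]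
    (hsymm : ∀ x : ℝ, ν (Set.Ici x) = ν (Set.Iic (-x))) {γ τ ε₀ : ℝ}
    (htan : ∀ᵐ a ∂ν, |Real.tan a| ≤ τ) {v : ℝ → ℝ} (hv : Measurable v) {h : ℝ → ℝ} {b₁ b₂ K : ℝ}
    (hh : Measurable h) (hK0 : 0 ≤ K)
    (hK : ∀ ε t, 0 < ε → ε ≤ ε₀ → |t| ≤ τ →
      |h (inverseSlope γ ε t * v (inverseSlope γ ε t)) - 2 * ε * b₁ * t
        - ε ^ 2 * (2 * γ * b₁ * (1 + 2 * t ^ 2) + 4 * b₂ * t ^ 2)| ≤ K * ε ^ 3) :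
    ∃ C : ℝ, 0 ≤ C ∧ ∀ ε, 0 < ε → ε ≤ ε₀ → ε ≤ 1 →
      Integrable (fun a => h (relativeJump γ v ε a)) ν ∧
      (∀ᵐ a ∂ν, |h (relativeJump γ v ε a)| ≤ C * ε) ∧
      |∫ a, h (relativeJump γ v ε a) ∂ν
        - 2 * ε ^ 2 * (b₁ * γ * (1 + 2 * meanTanSq ν) + 2 * b₂ * meanTanSq ν)| ≤ C * ε ^ 3 := by
  have hτ : 0 ≤ τ := by
    obtain ⟨a, ha⟩ := htan.exists
    exact (abs_nonneg _).trans ha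
  have htm := measurable_tan
  obtain ⟨E, hE⟩ : ∃ E, E = 2 * |b₁| * τ + |2 * γ * b₁| * (1 + 2 * τ ^ 2) + |4 * b₂| * τ ^ 2 :=
    ⟨_, rfl⟩
  have hE0 : 0 ≤ E := by rw [hE]; positivity
  refine ⟨K + E, by positivity, fun ε hε hle hε1 => ?_⟩
  have hJm : Measurable fun a => relativeJump γ v ε a :=
    (measurable_relativeJump γ hv).of_uncurry_left
  have e3 : ε ^ 3 ≤ ε := by
    have := pow_le_pow_of_le_one hε.le hε1 (show 1 ≤ 3 by norm_num)
    simpa using this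
  have e2 : ε ^ 2 ≤ ε := by nlinarith
  set T₁ : ℝ → ℝ := fun a => 2 * ε * b₁ * Real.tan a with hT₁
  set T₂ : ℝ → ℝ := fun a =>
    ε ^ 2 * (2 * γ * b₁ * (1 + 2 * Real.tan a ^ 2) + 4 * b₂ * Real.tan a ^ 2) with hT₂
  set r : ℝ → ℝ := fun a => h (relativeJump γ v ε a) - T₁ a - T₂ a with hr
  have hrb : ∀ᵐ a ∂ν, |r a| ≤ K * ε ^ 3 := by
    filter_upwards [htan] with a ha using hK ε (Real.tan a) hε hle ha
  have htsq : ∀ᵐ a ∂ν, Real.tan a ^ 2 ≤ τ ^ 2 := by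
    filter_upwards [htan] with a ha
    exact sq_le_sq' (by linarith [(abs_le.1 ha).1]) (abs_le.1 ha).2
  have hi1 : Integrable Real.tan ν := Integrable.of_bound htm.aestronglyMeasurable τ htan
  have hi2 : Integrable (fun a => Real.tan a ^ 2) ν :=
    Integrable.of_bound (htm.pow_const 2).aestronglyMeasurable (τ ^ 2) (by
      filter_upwards [htsq] with a ha
      rwa [Real.norm_eq_abs, abs_of_nonneg (sq_nonneg _)])
  have hiT₁ : Integrable T₁ ν := hi1.const_mul _
  have hiT₂ : Integrable T₂ ν :=
    ((((integrable_const _).add (hi2.const_mul _)).const_mul _).add (hi2.const_mul _)).const_mul _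
  have hir : Integrable r ν := Integrable.of_bound (by
    refine Measurable.aestronglyMeasurable (((hh.comp hJm).sub ?_).sub ?_) <;> fun_prop) _ hrb
  have hI : Integrable (fun a => h (relativeJump γ v ε a)) ν := by
    have := (hir.add hiT₁).add hiT₂
    refine this.congr (Eventually.of_forall fun a => ?_)
    simp only [hr, Pi.add_apply]
    ring
  refine ⟨hI, ?_, ?_⟩
  · filter_upwards [hrb, htan, htsq] with a ha ht ht2
    have h1 : |T₁ a| ≤ ε * (2 * |b₁| * τ) := by
      simp only [hT₁]
      rw [abs_mul, abs_mul, abs_mul, abs_two, abs_of_pos hε]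
      have := mul_le_mul_of_nonneg_left ht (by positivity : 0 ≤ 2 * ε * |b₁|)
      linarith
    have h2 : |T₂ a| ≤ ε * (|2 * γ * b₁| * (1 + 2 * τ ^ 2) + |4 * b₂| * τ ^ 2) := by
      simp only [hT₂]
      rw [abs_mul, abs_of_nonneg (sq_nonneg ε)]
      refine mul_le_mul e2 ((abs_add_le _ _).trans (add_le_add ?_ ?_)) (abs_nonneg _) hε.le
      · rw [abs_mul, abs_of_nonneg (by positivity : 0 ≤ 1 + 2 * Real.tan a ^ 2)]
        exact mul_le_mul_of_nonneg_left (by linarith) (abs_nonneg _)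
      · rw [abs_mul, abs_of_nonneg (sq_nonneg (Real.tan a))]
        exact mul_le_mul_of_nonneg_left ht2 (abs_nonneg _)
    have h3 := abs_add_three (r a) (T₁ a) (T₂ a)
    rw [show r a + T₁ a + T₂ a = h (relativeJump γ v ε a) by simp only [hr]; ring] at h3
    have h4 := mul_le_mul_of_nonneg_left e3 hK0
    rw [hE]
    linarith
  -- The first-order term is odd in the angle, so the drift is of order ε².
  · have h1 : ∫ a, T₁ a ∂ν = 0 :=
      integral_eq_zero_of_odd hsymm fun x => by simp [hT₁, Real.tan_neg]
    have h2 : ∫ a, T₂ a ∂ν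
        = 2 * ε ^ 2 * (b₁ * γ * (1 + 2 * meanTanSq ν) + 2 * b₂ * meanTanSq ν) := by
      have e : T₂ = fun a => 2 * ε ^ 2 * b₁ * γ
          + (4 * ε ^ 2 * (b₁ * γ + b₂)) * Real.tan a ^ 2 := by
        ext a; simp only [hT₂]; ring
      rw [e, integral_add (integrable_const _) (hi2.const_mul _), integral_const_mul (4 * ε ^ 2 * (b₁ * γ + b₂))]
      simp only [integral_const, probReal_univ, one_smul, meanTanSq]
      ring
    have h3 : ∫ a, r a ∂ν = ∫ a, h (relativeJump γ v ε a) ∂ν - ∫ a, T₁ a ∂ν - ∫ a, T₂ a ∂ν := by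
      have hI1 : Integrable (fun a => h (relativeJump γ v ε a) - T₁ a) ν := hI.sub hiT₁
      rw [← integral_sub hI hiT₁, ← integral_sub hI1 hiT₂]
    rw [h1, h2, sub_zero] at h3
    rw [← h3]
    have h4 := norm_integral_le_of_norm_le_const (f := r) (μ := ν) (C := K * ε ^ 3) hrb
    rw [probReal_univ, mul_one, Real.norm_eq_abs] at h4
    exact h4.trans (mul_le_mul_of_nonneg_right (by linarith) (by positivity))

/-! ### From the billiard to the stopped chain -/

section ReturnTime

variable {Ω : Type*} {γ A a₀ x₀ : ℝ} {v : ℝ → ℝ} {p : ℝ × ℝ} {α : ℕ → Ω → ℝ} {ω : Ω}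

/-- Until the first coordinate is at most `2A`, it follows the stopped chain. -/
lemma exists_collisions_eq
    (hstep : StepFollows γ A a₀ v)
    (hp : p ∈ frontier (tube (fun x => x ^ γ) A)) (hα : ∀ n, |α n ω| < a₀) (n : ℕ)
    (hn : ∀ m < n, 2 * A < chain (stoppedMap γ A a₀ v) p.1 α m ω) :
    ∃ q ∈ frontier (tube (fun x => x ^ γ) A),
      collisions (fun x => x ^ γ) A p α n ω = some q ∧
        q.1 = chain (stoppedMap γ A a₀ v) p.1 α n ω := by
  induction n with
  | zero => exact ⟨p, hp, rfl, rfl⟩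
  | succ n ih =>
    obtain ⟨q, hq, hq1, hq2⟩ := ih fun m hm => hn m (hm.trans n.lt_succ_self)
    obtain ⟨r, hr, hr1, hr2⟩ := hstep q hq (hq2 ▸ hn n n.lt_succ_self) (α n ω) (hα n)
    exact ⟨r, hr, by rw [collisions, hq1, hr1], by rw [hr2, hq2, chain]⟩

lemma returnTime_lt_top
    (hstep : StepFollows γ A a₀ v)
    (hp : p ∈ frontier (tube (fun x => x ^ γ) A))
    (hα : ∀ n, |α n ω| < a₀)
    (hex : ∃ n, chain (stoppedMap γ A a₀ v) p.1 α n ω ≤ 2 * A) :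
    returnTime A (collisions (fun x => x ^ γ) A p α) ω < ⊤ := by
  classical
  -- At the first time the chain is at most 2A it still agrees with the billiard, since only
  -- survival at strictly earlier times is needed.
  obtain ⟨q, -, hq1, hq2⟩ := exists_collisions_eq hstep hp hα (Nat.find hex)
    fun m hm => not_le.1 (Nat.find_min hex hm)
  have : returnTime A (collisions (fun x => x ^ γ) A p α) ω ≤ (Nat.find hex : ℕ∞) :=
    sInf_le ⟨_, ⟨q, hq1, hq2 ▸ Nat.find_spec hex⟩, rfl⟩
  exact this.trans_lt (ENat.natCast_lt_top _)

/-- If the return time is m, the chain is killed by time m and stays killed, so at most m terms are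
1; if it is ⊤ there is nothing to prove. -/
lemma sum_survival_le_returnTime
    (hstep : StepFollows γ A a₀ v)
    (hp : p ∈ frontier (tube (fun x => x ^ γ) A))
    (hF : IsKilledMap (stoppedMap γ A a₀ v) (2 * A)) (hα : ∀ n, |α n ω| < a₀) (N : ℕ) :
    ∑ k ∈ Finset.range N, {ω | 2 * A < chain (stoppedMap γ A a₀ v) p.1 α k ω}.indicator
      (fun _ => (1 : ℝ≥0∞)) ω ≤ (returnTime A (collisions (fun x => x ^ γ) A p α) ω : ℝ≥0∞) := by
  classical
  set S := (fun n : ℕ => (n : ℕ∞)) ''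
    {n : ℕ | ∃ q : ℝ × ℝ, collisions (fun x => x ^ γ) A p α n ω = some q ∧ q.1 ≤ 2 * A} with hS
  rcases S.eq_empty_or_nonempty with he | hne
  · rw [returnTime, ← hS, he, sInf_empty]
    simp
  · obtain ⟨m, ⟨q, hq1, hq2⟩, hm⟩ := csInf_mem hne
    rw [returnTime, ← hS, ← hm]
    have hdead : ∀ k, m ≤ k → ¬ 2 * A < chain (stoppedMap γ A a₀ v) p.1 α k ω := by
      intro k hmk hk
      obtain ⟨q', -, hq1', hq2'⟩ := exists_collisions_eq hstep hp hα m
        fun i hi => hF.survival_antitone (hi.le.trans hmk) hk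
      rw [hq1, Option.some.injEq] at hq1'
      rw [hq1', hq2'] at hq2
      exact absurd (hF.survival_antitone hmk hk) (not_lt.2 hq2)
    have h1 : ∀ k ∈ Finset.range N, {ω | 2 * A < chain (stoppedMap γ A a₀ v) p.1 α k ω}.indicator
        (fun _ => (1 : ℝ≥0∞)) ω ≤ if k < m then 1 else 0 := by
      intro k _
      split_ifs with hk
      · exact Set.indicator_le_self' (fun _ _ => zero_le) ω
      · simp [Set.indicator, hdead k (not_lt.1 hk)]
    refine (Finset.sum_le_sum h1).trans ?_
    rw [Finset.sum_boole]
    simp only [ENat.toENNReal_coe, Nat.cast_le]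
    calc _ ≤ (Finset.range m).card := Finset.card_le_card fun k hk => by
          simpa using (Finset.mem_filter.1 hk).2
      _ = m := Finset.card_range m

end ReturnTime

/-- Surviving forever has probability at most every survival probability, hence 0; and the mean
return time dominates every partial sum of those probabilities. -/
lemma isNullRecurrent_of_survival {Ω : Type*} [MeasurableSpace Ω] {P : Measure Ω}
    [IsProbabilityMeasure P] {γ A a₀ : ℝ} {v : ℝ → ℝ} {p : ℝ × ℝ} {α : ℕ → Ω → ℝ}
    (hstep : StepFollows γ A a₀ v)
    (hp : p ∈ frontier (tube (fun x => x ^ γ) A))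
    (hF : IsKilledMap (stoppedMap γ A a₀ v) (2 * A)) (hαm : ∀ k, Measurable (α k))
    (hα : ∀ᵐ ω ∂P, ∀ n, |α n ω| < a₀)
    (hlim : Tendsto (fun n => P.real {ω | 2 * A < chain (stoppedMap γ A a₀ v) p.1 α n ω}) atTop
      (𝓝 0))
    (hsum : ¬ Summable fun n => P.real {ω | 2 * A < chain (stoppedMap γ A a₀ v) p.1 α n ω}) :
    IsNullRecurrent P A (collisions (fun x => x ^ γ) A p α) := by
  constructor
  · have h0 : P.real {ω | ∀ n, 2 * A < chain (stoppedMap γ A a₀ v) p.1 α n ω} = 0 :=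
      le_antisymm (ge_of_tendsto' hlim fun n => measureReal_mono fun ω hω => hω n)
        measureReal_nonneg
    rw [measureReal_eq_zero_iff] at h0
    have h1 : ∀ᵐ ω ∂P, ¬ ∀ n, 2 * A < chain (stoppedMap γ A a₀ v) p.1 α n ω := by
      rw [ae_iff]
      simpa using h0
    filter_upwards [hα, h1] with ω hω h2
    push Not at h2
    exact returnTime_lt_top hstep hp hω h2
  · by_contra hfin
    refine hsum (summable_of_sum_range_le (fun _ => measureReal_nonneg)
      (c := (∫⁻ ω, (returnTime A (collisions (fun x => x ^ γ) A p α) ω : ℝ≥0∞) ∂P).toReal)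
      fun N => ?_)
    have hset : ∀ n, MeasurableSet {ω | 2 * A < chain (stoppedMap γ A a₀ v) p.1 α n ω} := fun n =>
      measurableSet_lt measurable_const (hF.measurable_chain hαm n)
    have h1 : ∑ k ∈ Finset.range N, P {ω | 2 * A < chain (stoppedMap γ A a₀ v) p.1 α k ω}
        ≤ ∫⁻ ω, (returnTime A (collisions (fun x => x ^ γ) A p α) ω : ℝ≥0∞) ∂P := by
      calc _ = ∫⁻ ω, ∑ k ∈ Finset.range N,
            {ω | 2 * A < chain (stoppedMap γ A a₀ v) p.1 α k ω}.indicator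
              (fun _ => (1 : ℝ≥0∞)) ω ∂P := by
            rw [lintegral_finsetSum _ fun k _ => measurable_const.indicator (hset k)]
            refine Finset.sum_congr rfl fun k _ => ?_
            rw [lintegral_indicator_const (hset k), one_mul]
        _ ≤ _ := lintegral_mono_ae (hα.mono fun ω hω =>
            sum_survival_le_returnTime hstep hp hF hω N)
    have h2 := ENNReal.toReal_mono hfin h1
    rwa [ENNReal.toReal_sum fun k _ => measure_ne_top _ _] at h2

/-! ### Moments of the stopped map -/

section StoppedMap

variable {γ A a₀ ε₀ : ℝ} {v : ℝ → ℝ}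

/-- Every ray at angle less than `a₀` is a chord of the tube, where the scaled width of the tube
is at most `ε₀`. -/
def AreFlights (γ a₀ ε₀ : ℝ) (v : ℝ → ℝ) : Prop :=
  ∀ ε a, 0 < ε → ε ≤ ε₀ → |a| < a₀ → 0 < 1 - γ * ε * Real.tan a ∧
    IsFlight γ (inverseSlope γ ε (Real.tan a)) (v (inverseSlope γ ε (Real.tan a)))

lemma stoppedMap_eq {x a : ℝ} (hx : 2 * A < x) (ha : |a| < a₀) :
    stoppedMap γ A a₀ v x a = x * (1 + relativeJump γ v (x ^ (γ - 1)) a) :=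
  if_pos ⟨hx, ha⟩

lemma AreFlights.abs_relativeJump_le (hv : AreFlights γ a₀ ε₀ v) {ε a : ℝ} (h0 : 0 < ε)
    (hε : ε ≤ ε₀) (ha : |a| < a₀) : |relativeJump γ v ε a| ≤ 1 / 2 :=
  (hv ε a h0 hε ha).2.2.2.1

lemma AreFlights.isKilledMap (hv : AreFlights γ a₀ ε₀ v) (hvm : Measurable v) (hA : 0 < A)
    (hε : ∀ x, 2 * A < x → x ^ (γ - 1) ≤ ε₀) :
    IsKilledMap (stoppedMap γ A a₀ v) (2 * A) where
  measurable := by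
    refine Measurable.ite ?_ ?_ measurable_fst
    · exact (measurableSet_lt measurable_const measurable_fst).inter
        (measurableSet_lt (continuous_abs.measurable.comp measurable_snd) measurable_const)
    · refine measurable_fst.mul (Measurable.const_add ?_ 1)
      have hw : Measurable fun q : ℝ × ℝ => q.1 ^ (γ - 1) := by fun_prop
      exact (measurable_relativeJump γ hvm).comp (hw.prodMk measurable_snd)
  pos := by linarith
  absorbed x a hx := if_neg fun h => absurd h.1 (not_lt.2 hx)
  half_le x a hx := by
    have hx0 : 0 < x := by linarith
    by_cases ha : |a| < a₀
    · rw [stoppedMap_eq hx ha]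
      have := abs_le.1
        (hv.abs_relativeJump_le (Real.rpow_pos_of_pos hx0 (γ - 1)) (hε x hx) ha)
      nlinarith
    · rw [stoppedMap, if_neg fun h => ha h.2]
      linarith
  le_double x a hx := by
    have hx0 : 0 < x := by linarith
    by_cases ha : |a| < a₀
    · rw [stoppedMap_eq hx ha]
      have := abs_le.1
        (hv.abs_relativeJump_le (Real.rpow_pos_of_pos hx0 (γ - 1)) (hε x hx) ha)
      nlinarith
    · rw [stoppedMap, if_neg fun h => ha h.2]
      linarith

lemma AreFlights.stepFollows (hv : AreFlights γ a₀ ε₀ v) (hA : 0 < A) (ha₀ : a₀ < Real.pi / 2)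
    (hε : ∀ x, 2 * A < x → x ^ (γ - 1) ≤ ε₀) : StepFollows γ A a₀ v := by
  intro q hq hAq a ha
  obtain ⟨h1, h2⟩ := hv _ a (Real.rpow_pos_of_pos (by linarith) (γ - 1)) (hε q.1 hAq) ha
  have hcos : 0 < Real.cos a :=
    Real.cos_pos_of_mem_Ioo ⟨by linarith [(abs_lt.1 ha).1], by linarith [(abs_lt.1 ha).2]⟩
  obtain ⟨r, hr, hr1, hr2⟩ := step_rpow hA hq hAq hcos h1 h2
  exact ⟨r, hr, hr1, by rw [hr2, stoppedMap_eq hAq ha]; rfl⟩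

variable {ν : Measure ℝ} [IsProbabilityMeasure ν]

lemma AreFlights.rpow_stoppedMap (hv : AreFlights γ a₀ ε₀ v) (hA : 0 < A)
    (hε : ∀ x, 2 * A < x → x ^ (γ - 1) ≤ ε₀) (p : ℝ) {x a : ℝ} (hx : 2 * A < x) (ha : |a| < a₀) :
    stoppedMap γ A a₀ v x a ^ p
      = x ^ p + x ^ p * ((1 + relativeJump γ v (x ^ (γ - 1)) a) ^ p - 1) := by
  have hx0 : 0 < x := by linarith
  have := abs_le.1 (hv.abs_relativeJump_le (Real.rpow_pos_of_pos hx0 (γ - 1)) (hε x hx) ha)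
  rw [stoppedMap_eq hx ha, Real.mul_rpow hx0.le (by linarith)]
  ring

lemma AreFlights.integral_rpow_stoppedMap (hv : AreFlights γ a₀ ε₀ v) (hA : 0 < A)
    (hε : ∀ x, 2 * A < x → x ^ (γ - 1) ≤ ε₀) (ha : ∀ᵐ a ∂ν, |a| < a₀) (p : ℝ) {x : ℝ}
    (hx : 2 * A < x)
    (hi : Integrable (fun a => (1 + relativeJump γ v (x ^ (γ - 1)) a) ^ p - 1) ν) :
    Integrable (fun a => stoppedMap γ A a₀ v x a ^ p) ν ∧
      ∫ a, stoppedMap γ A a₀ v x a ^ p ∂ν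
        = x ^ p + x ^ p * ∫ a, ((1 + relativeJump γ v (x ^ (γ - 1)) a) ^ p - 1) ∂ν := by
  have h : (fun a => stoppedMap γ A a₀ v x a ^ p) =ᵐ[ν]
      fun a => x ^ p + x ^ p * ((1 + relativeJump γ v (x ^ (γ - 1)) a) ^ p - 1) := by
    filter_upwards [ha] with a ha using hv.rpow_stoppedMap hA hε p hx ha
  refine ⟨((integrable_const _).add (hi.const_mul _)).congr h.symm, ?_⟩
  rw [integral_congr_ae h, integral_add (integrable_const _) (hi.const_mul _), integral_const_mul]
  simp

lemma AreFlights.integral_log_stoppedMap (hv : AreFlights γ a₀ ε₀ v) (hA : 0 < A)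
    (hε : ∀ x, 2 * A < x → x ^ (γ - 1) ≤ ε₀) (ha : ∀ᵐ a ∂ν, |a| < a₀) {x : ℝ}
    (hx : 2 * A < x)
    (hi : Integrable (fun a => Real.log (1 + relativeJump γ v (x ^ (γ - 1)) a)) ν) :
    Integrable (fun a => Real.log (stoppedMap γ A a₀ v x a)) ν ∧
      ∫ a, Real.log (stoppedMap γ A a₀ v x a) ∂ν
        = Real.log x + ∫ a, Real.log (1 + relativeJump γ v (x ^ (γ - 1)) a) ∂ν := by
  have hx0 : 0 < x := by linarith
  have h : (fun a => Real.log (stoppedMap γ A a₀ v x a)) =ᵐ[ν]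
      fun a => Real.log x + Real.log (1 + relativeJump γ v (x ^ (γ - 1)) a) := by
    filter_upwards [ha] with a ha
    have := abs_le.1 (hv.abs_relativeJump_le (Real.rpow_pos_of_pos hx0 (γ - 1)) (hε x hx) ha)
    rw [stoppedMap_eq hx ha, Real.log_mul hx0.ne' (by linarith)]
  refine ⟨((integrable_const _).add hi).congr h.symm, ?_⟩
  rw [integral_congr_ae h, integral_add (integrable_const _) hi]
  simp

end StoppedMap

/-! ### Drift coefficients and null recurrence -/

/-- `γ (1 + 2 E[tan² α]) + (p - 1) E[tan² α]`; its sign is that of the drift of `ξ⁽¹⁾ ^ p / p`. -/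
noncomputable def driftCoeff (ν : Measure ℝ) (γ p : ℝ) : ℝ :=
  γ * (1 + 2 * meanTanSq ν) + (p - 1) * meanTanSq ν

lemma exists_moment_bounds {ν : Measure ℝ} [IsProbabilityMeasure ν] (hν : IsReflectionLaw ν)
    (γ : ℝ) :
    ∃ a₀ < Real.pi / 2, (∀ᵐ a ∂ν, |a| < a₀) ∧ ∃ v, Measurable v ∧ ∃ ε₀ : ℝ, 0 < ε₀ ∧
      AreFlights γ a₀ ε₀ v ∧
      (∀ p, ∃ C : ℝ, 0 ≤ C ∧ ∀ ε, 0 < ε → ε ≤ ε₀ → ε ≤ 1 →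
        Integrable (fun a => (1 + relativeJump γ v ε a) ^ p - 1) ν ∧
        (∀ᵐ a ∂ν, |(1 + relativeJump γ v ε a) ^ p - 1| ≤ C * ε) ∧
        |∫ a, ((1 + relativeJump γ v ε a) ^ p - 1) ∂ν
          - 2 * ε ^ 2 * (p * driftCoeff ν γ p)| ≤ C * ε ^ 3) ∧
      ∃ C : ℝ, 0 ≤ C ∧ ∀ ε, 0 < ε → ε ≤ ε₀ → ε ≤ 1 →
        Integrable (fun a => Real.log (1 + relativeJump γ v ε a)) ν ∧
        |∫ a, Real.log (1 + relativeJump γ v ε a) ∂ν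
          - 2 * ε ^ 2 * driftCoeff ν γ 0| ≤ C * ε ^ 3 := by
  obtain ⟨⟨a₀, ⟨ha0, ha1⟩, ha⟩, hsymm⟩ := hν
  have htan : ∀ a, |a| < a₀ → |Real.tan a| ≤ Real.tan a₀ := fun a ha => by
    obtain ⟨h1, h2⟩ := abs_lt.1 ha
    refine abs_le.2 ⟨?_, (Real.tan_lt_tan_of_lt_of_lt_pi_div_two (by linarith) ha1 h2).le⟩
    rw [← Real.tan_neg]
    exact (Real.tan_lt_tan_of_lt_of_lt_pi_div_two (by linarith) (by linarith) h1).le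
  have hτ : 0 ≤ Real.tan a₀ := (abs_nonneg _).trans (htan 0 (by simpa using ha0))
  have htan' : ∀ᵐ a ∂ν, |Real.tan a| ≤ Real.tan a₀ := ha.mono htan
  obtain ⟨v, hv, ε₀, hε₀, hfl, hexp⟩ := exists_jump_expansion γ hτ
  refine ⟨a₀, ha1, ha, v, hv, ε₀, hε₀, fun ε a h0 hε ha => hfl ε _ h0 hε (htan a ha),
    fun p => ?_, ?_⟩
  · obtain ⟨K, hK0, hK⟩ := hexp _ _ _ (hasQuadraticExpansion_rpow p)
    obtain ⟨C, hC0, hC⟩ := exists_drift_expansion hsymm htan' hv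
      (h := fun z => (1 + z) ^ p - 1) (by fun_prop) hK0 hK
    refine ⟨C, hC0, fun ε h0 hε h1 => ?_⟩
    obtain ⟨h2, h3, h4⟩ := hC ε h0 hε h1
    refine ⟨h2, h3, ?_⟩
    convert h4 using 5
    unfold driftCoeff
    ring
  · obtain ⟨K, hK0, hK⟩ := hexp _ _ _ hasQuadraticExpansion_log
    obtain ⟨C, hC0, hC⟩ := exists_drift_expansion hsymm htan' hv
      (h := fun z => Real.log (1 + z)) (by fun_prop) hK0 hK
    refine ⟨C, hC0, fun ε h0 hε h1 => ?_⟩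
    obtain ⟨h2, -, h4⟩ := hC ε h0 hε h1
    refine ⟨h2, ?_⟩
    convert h4 using 5
    unfold driftCoeff
    ring

/-- I and J are the relative drifts of log x and x^(-δ), and s = x^(-δ), ε = s². Even for κ = 0 the
correction contributes -2s⁵δ²m; half of it absorbs the errors of order s⁶. -/
lemma drift_log_le {s δ m κ C₀ C₁ I J : ℝ} (hs0 : 0 < s) (hs1 : s ≤ 1) (hδ : 0 < δ)
    (hκ : κ ≤ 0) (hC : 0 ≤ C₁)
    (hs : (C₀ + C₁) * s ≤ δ ^ 2 * m)
    (hI : |I - 2 * (s ^ 2) ^ 2 * κ| ≤ C₀ * (s ^ 2) ^ 3)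
    (hJ : |J - 2 * (s ^ 2) ^ 2 * (-δ * (κ - δ * m))| ≤ C₁ * (s ^ 2) ^ 3) :
    I - s * J ≤ -(s ^ 5 * (δ ^ 2 * m)) := by
  have h1 := (abs_le.1 hI).2
  have h2 := mul_le_mul_of_nonneg_left (abs_le.1 hJ).1 hs0.le
  have h3 : C₁ * s ^ 7 ≤ C₁ * s ^ 6 :=
    mul_le_mul_of_nonneg_left (pow_le_pow_of_le_one hs0.le hs1 (by norm_num)) hC
  have h4 := mul_le_mul_of_nonneg_left hs (pow_pos hs0 5).le
  have h5 : s ^ 4 * κ ≤ 0 := mul_nonpos_of_nonneg_of_nonpos (by positivity) hκ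
  have h6 : s ^ 5 * δ * κ ≤ 0 := mul_nonpos_of_nonneg_of_nonpos (by positivity) hκ
  ring_nf at *
  linarith

/-- I and J are the relative drifts of x^p and x^q with p = q + δ in the application. The smaller
exponent has drift coefficient lower by δm, which leaves 2qδm·s⁵ to absorb errors of order s⁶ even
for κ = 0. -/
lemma drift_rpow_nonneg {s δ m κ p q C₄ C₃ I J : ℝ} (hs0 : 0 < s) (hs1 : s ≤ 1) (hq : 0 < q)
    (hqp : q ≤ p) (hκ : 0 ≤ κ) (hC : 0 ≤ C₃)
    (hs : (C₄ + C₃) * s ≤ 2 * q * δ * m)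
    (hI : |I - 2 * (s ^ 2) ^ 2 * (p * κ)| ≤ C₄ * (s ^ 2) ^ 3)
    (hJ : |J - 2 * (s ^ 2) ^ 2 * (q * (κ - δ * m))| ≤ C₃ * (s ^ 2) ^ 3) :
    0 ≤ I - s * J := by
  have h1 := (abs_le.1 hI).1
  have h2 := mul_le_mul_of_nonneg_left (abs_le.1 hJ).2 hs0.le
  have h3 : C₃ * s ^ 7 ≤ C₃ * s ^ 6 :=
    mul_le_mul_of_nonneg_left (pow_le_pow_of_le_one hs0.le hs1 (by norm_num)) hC
  have h4 := mul_le_mul_of_nonneg_left hs (pow_pos hs0 5).le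
  have h5 : 0 ≤ s ^ 4 * κ * (p - s * q) := by
    refine mul_nonneg (by positivity) ?_
    nlinarith
  ring_nf at *
  linarith

/-- Null recurrence between the two critical exponents. -/
theorem nullRecurrentForLargeA_rpow {ν : Measure ℝ} [IsProbabilityMeasure ν]
    (hν : IsReflectionLaw ν) {γ : ℝ} (hγ : γ < 1) (hm : 0 < meanTanSq ν)
    (hκ₀ : driftCoeff ν γ 0 ≤ 0) (hκ : 0 ≤ driftCoeff ν γ (2 - 2 * γ)) :
    NullRecurrentForLargeA.{u} ν (fun x => x ^ γ) := by
  obtain ⟨a₀, ha₀, ha, v, hvm, ε₀, hε₀, hv, hpow, C₀, hC₀0, hC₀⟩ := exists_moment_bounds hν γ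
  -- With this δ, x^(-δ) is the square root of ε = x^(γ-1), x^(2δ) = 1/ε is the Lamperti scale and
  -- x^(4δ) its square.
  obtain ⟨δ, hδ⟩ : ∃ δ, δ = (1 - γ) / 2 := ⟨_, rfl⟩
  have hδ0 : 0 < δ := by linarith
  have hδ1 : γ - 1 = -δ * 2 := by rw [hδ]; ring
  obtain ⟨C₁, hC₁0, hC₁⟩ := hpow (-δ)
  obtain ⟨C₂, hC₂0, hC₂⟩ := hpow (2 * δ)
  obtain ⟨C₃, hC₃0, hC₃⟩ := hpow (3 * δ)
  obtain ⟨C₄, hC₄0, hC₄⟩ := hpow (4 * δ)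
  have hκ4 : 0 ≤ driftCoeff ν γ (4 * δ) := by
    rwa [show 4 * δ = 2 - 2 * γ by rw [hδ]; ring]
  have hκ3 : driftCoeff ν γ (3 * δ) = driftCoeff ν γ (4 * δ) - δ * meanTanSq ν := by
    unfold driftCoeff; ring
  have hκ1 : driftCoeff ν γ (-δ) = driftCoeff ν γ 0 - δ * meanTanSq ν := by
    unfold driftCoeff; ring
  rw [hκ3] at hC₃
  rw [hκ1] at hC₁
  generalize hmm : meanTanSq ν = m at hm hC₃ hC₁
  have hs_tendsto : Tendsto (fun x : ℝ => x ^ (-δ)) atTop (𝓝 0) := tendsto_rpow_neg_atTop hδ0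
  have hev : ∀ {C r : ℝ}, 0 < r → ∀ᶠ x : ℝ in atTop, C * x ^ (-δ) ≤ r := fun {C r} hr => by
    have h := hs_tendsto.const_mul C
    rw [mul_zero] at h
    exact (h.eventually_lt_const hr).mono fun _ => le_of_lt
  have hev2 : ∀ᶠ x : ℝ in atTop, (x ^ (-δ)) ^ 2 ≤ ε₀ := by
    have h := hs_tendsto.pow 2
    rw [zero_pow two_ne_zero] at h
    exact (h.eventually_lt_const hε₀).mono fun _ => le_of_lt
  obtain ⟨A₀, hA₀⟩ := eventually_atTop.1 (hev2.and ((hev (C := C₀ + C₁) (r := δ ^ 2 * m)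
    (by positivity)).and (hev (C := C₄ + C₃) (r := 2 * (3 * δ) * δ * m) (by positivity))))
  refine ⟨max A₀ 1, by positivity, ?_⟩
  intro A hA1 hAA Ω _ P _ α hαm hαi hαν p hp hpA
  have hA : 0 < A := by linarith
  have hgood : ∀ x, 2 * A < x → A₀ ≤ x := fun x hx => by
    linarith [(le_max_left A₀ 1).trans hAA.le]
  have hs2 : ∀ x : ℝ, 0 < x → x ^ (γ - 1) = (x ^ (-δ)) ^ 2 := fun x hx => by
    rw [hδ1, Real.rpow_mul hx.le]
    norm_num
  have hspos : ∀ x : ℝ, 0 < x → 0 < x ^ (-δ) := fun x hx => Real.rpow_pos_of_pos hx _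
  have hs1 : ∀ x : ℝ, 1 ≤ x → x ^ (-δ) ≤ 1 := fun x hx =>
    Real.rpow_le_one_of_one_le_of_nonpos hx (by linarith)
  have hε : ∀ x, 2 * A < x → x ^ (γ - 1) ≤ ε₀ := fun x hx => by
    rw [hs2 x (by linarith)]
    exact (hA₀ x (hgood x hx)).1
  have hε1 : ∀ x, 2 * A < x → x ^ (γ - 1) ≤ 1 := fun x hx =>
    Real.rpow_le_one_of_one_le_of_nonpos (by linarith) (by linarith)
  have hεpos : ∀ x, 2 * A < x → 0 < x ^ (γ - 1) := fun x hx =>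
    Real.rpow_pos_of_pos (by linarith) _
  have hF := hv.isKilledMap hvm hA hε
  have hαa : ∀ᵐ ω ∂P, ∀ n, |α n ω| < a₀ := ae_all_iff.2 fun n =>
    ae_of_ae_map (hαm n).aemeasurable ((hαν n).symm ▸ ha)
  have hhalf : 2 * A / 2 = A := by ring
  refine isNullRecurrent_of_survival (hv.stepFollows hA ha₀ hε) hp hF hαm hαa ?_ ?_
  -- The added 1 makes the function nonnegative on x ≥ A ≥ 1.
  · refine hF.tendsto_survival hpA hαm hαi hαν (f := fun x => Real.log x - x ^ (-δ) + 1)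
      (by fun_prop) ?_ ?_ ?_ ?_
    · intro x hx
      rw [hhalf] at hx
      linarith [Real.log_nonneg (hA1.trans hx), hs1 x (hA1.trans hx)]
    · intro x hx y hy hxy
      rw [hhalf] at hx hy
      have hx0 : 0 < x := hA.trans_le hx
      have h1 := Real.log_le_log hx0 hxy
      have h2 := Real.rpow_le_rpow_of_nonpos hx0 hxy (by linarith : -δ ≤ 0)
      simp only
      linarith
    · have : Tendsto (fun x : ℝ => Real.log x + (-x ^ (-δ) + 1)) atTop atTop :=
        Real.tendsto_log_atTop.atTop_add (hs_tendsto.neg.add_const 1)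
      refine this.congr fun x => ?_
      ring
    · intro R
      -- The drift bound s⁵δ²m decreases in x, so on x ≤ R its value at R is uniform; the maximum
      -- with 1 keeps the base positive.
      refine ⟨((max R 1) ^ (-δ)) ^ 5 * (δ ^ 2 * m), by positivity, fun x hx => ?_⟩
      have hx0 : 0 < x := by linarith
      obtain ⟨h1, h2⟩ := hC₀ _ (hεpos x hx) (hε x hx) (hε1 x hx)
      obtain ⟨h3, -, h4⟩ := hC₁ _ (hεpos x hx) (hε x hx) (hε1 x hx)
      obtain ⟨h5, h6⟩ := hv.integral_log_stoppedMap hA hε ha hx h1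
      obtain ⟨h7, h8⟩ := hv.integral_rpow_stoppedMap hA hε ha (-δ) hx h3
      have h9 : ∫ a, (Real.log (stoppedMap γ A a₀ v x a) - stoppedMap γ A a₀ v x a ^ (-δ) + 1) ∂ν
          = ∫ a, Real.log (stoppedMap γ A a₀ v x a) ∂ν
            - ∫ a, stoppedMap γ A a₀ v x a ^ (-δ) ∂ν + 1 := by
        have h57 : Integrable (fun a => Real.log (stoppedMap γ A a₀ v x a)
          - stoppedMap γ A a₀ v x a ^ (-δ)) ν := h5.sub h7
        rw [integral_add h57 (integrable_const _), integral_sub h5 h7]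
        simp
      rw [h9, h6, h8]
      rw [hs2 x hx0] at h2 h4 ⊢
      have h10 := drift_log_le (hspos x hx0) (hs1 x (by linarith)) hδ0 hκ₀ hC₁0
        (hA₀ x (hgood x hx)).2.1 h2 h4
      have h11 : 0 ≤ (x ^ (-δ)) ^ 5 * (δ ^ 2 * m) := by positivity
      split_ifs with hR
      · have h12 : (max R 1) ^ (-δ) ≤ x ^ (-δ) :=
          Real.rpow_le_rpow_of_nonpos hx0 (hR.trans (le_max_left _ _)) (by linarith)
        have h13 : ((max R 1) ^ (-δ)) ^ 5 * (δ ^ 2 * m) ≤ (x ^ (-δ)) ^ 5 * (δ ^ 2 * m) := by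
          gcongr
        linarith
      · linarith
  · have hsplit : ∀ x : ℝ, 0 < x → x ^ (3 * δ) = x ^ (4 * δ) * x ^ (-δ) := fun x hx => by
      rw [← Real.rpow_add hx]
      congr 1
      ring
    have hYinv : ∀ x : ℝ, 0 < x → x ^ (2 * δ) * x ^ (γ - 1) = 1 := fun x hx => by
      rw [← Real.rpow_add hx, hδ1, show 2 * δ + -δ * 2 = 0 by ring, Real.rpow_zero]
    have hYdiff : ∀ x, 2 * A < x → ∀ a, |a| < a₀ →
        stoppedMap γ A a₀ v x a ^ (2 * δ) - x ^ (2 * δ)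
          = x ^ (2 * δ) * ((1 + relativeJump γ v (x ^ (γ - 1)) a) ^ (2 * δ) - 1) :=
      fun x hx a ha => by
        rw [hv.rpow_stoppedMap hA hε _ hx ha]
        ring
    obtain ⟨E, hE⟩ : ∃ E, E = 2 * |2 * δ * driftCoeff ν γ (2 * δ)| + C₂ := ⟨_, rfl⟩
    have hE0 : 0 ≤ E := by rw [hE]; positivity
    refine hF.not_summable_survival hpA hαm hαi hαν (Y := fun x => x ^ (2 * δ))
      (f := fun x => x ^ (4 * δ) - x ^ (3 * δ)) (C := C₂ + E) (by fun_prop) (by fun_prop)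
      ?_ ?_ ?_ ?_ ?_ ?_ ?_ ?_
    · intro x hx y hy hxy
      rw [hhalf] at hx
      exact Real.rpow_le_rpow (hA.le.trans hx) hxy (by positivity)
    · intro x hx
      rw [hhalf] at hx
      exact Real.rpow_pos_of_pos (hA.trans_le hx) _
    · intro x hx
      have hx0 : 0 < x := by linarith
      filter_upwards [ha, (hC₂ _ (hεpos x hx) (hε x hx) (hε1 x hx)).2.1] with a ha hb
      have hY0 : 0 < x ^ (2 * δ) := Real.rpow_pos_of_pos hx0 _
      rw [hYdiff x hx a ha, abs_mul, abs_of_pos hY0]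
      have := mul_le_mul_of_nonneg_left hb hY0.le
      have h1 := hYinv x hx0
      have h2 : x ^ (2 * δ) * (C₂ * x ^ (γ - 1)) = C₂ := by
        rw [mul_left_comm, h1, mul_one]
      linarith
    · intro x hx
      have hx0 : 0 < x := by linarith
      have hY0 : 0 < x ^ (2 * δ) := Real.rpow_pos_of_pos hx0 _
      rw [integral_congr_ae (ha.mono fun a ha => hYdiff x hx a ha), integral_const_mul, abs_mul,
        abs_of_pos hY0, le_div_iff₀ hY0]
      have hY1 := hYinv x hx0
      have h1 := (hC₂ _ (hεpos x hx) (hε x hx) (hε1 x hx)).2.2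
      have he0 := hεpos x hx
      have he1 := hε1 x hx
      generalize x ^ (γ - 1) = ε at h1 he0 he1 hY1 ⊢
      generalize ∫ a, ((1 + relativeJump γ v ε a) ^ (2 * δ) - 1) ∂ν = I at h1 ⊢
      generalize x ^ (2 * δ) = y at hY0 hY1 ⊢
      have h2 : |I| ≤ E * ε ^ 2 := by
        have h3 := abs_add_le (I - 2 * ε ^ 2 * (2 * δ * driftCoeff ν γ (2 * δ)))
          (2 * ε ^ 2 * (2 * δ * driftCoeff ν γ (2 * δ)))
        rw [sub_add_cancel, abs_mul (2 * ε ^ 2), abs_of_pos (by positivity : 0 < 2 * ε ^ 2)] at h3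
        have h4 : C₂ * ε ^ 3 ≤ C₂ * ε ^ 2 :=
          mul_le_mul_of_nonneg_left (pow_le_pow_of_le_one he0.le he1 (by norm_num)) hC₂0
        rw [hE]
        linarith
      -- Because yε = 1, a relative drift of order ε² becomes an absolute drift of order 1/y.
      calc y * |I| * y ≤ y * (E * ε ^ 2) * y := by gcongr
        _ = E * (y * ε) ^ 2 := by ring
        _ ≤ C₂ + E := by rw [hY1]; linarith
    · intro x hx
      rw [hhalf] at hx
      exact sub_nonneg.2 (Real.rpow_le_rpow_of_exponent_le (hA1.trans hx) (by linarith))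
    · intro x hx
      rw [hhalf] at hx
      have hx0 := hA.trans_le hx
      have h1 : (x ^ (2 * δ)) ^ 2 = x ^ (4 * δ) := by
        rw [← Real.rpow_natCast, ← Real.rpow_mul hx0.le]
        congr 1
        push_cast
        ring
      simp only [h1]
      linarith [Real.rpow_pos_of_pos hx0 (3 * δ)]
    · intro x hx y hy hxy
      rw [hhalf, Set.mem_Ici] at hx hy
      have hx0 := hA.trans_le hx
      have hy0 := hA.trans_le hy
      simp only
      have e : ∀ z : ℝ, 0 < z → z ^ (4 * δ) - z ^ (3 * δ) = z ^ (4 * δ) * (1 - z ^ (-δ)) :=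
        fun z hz => by rw [hsplit z hz]; ring
      rw [e x hx0, e y hy0]
      have h1 := Real.rpow_lt_rpow hx0.le hxy (by positivity : 0 < 4 * δ)
      have h2 := Real.rpow_lt_rpow_of_neg hx0 hxy (by linarith : -δ < 0)
      have h3 := hs1 x (hA1.trans hx)
      have h4 := Real.rpow_pos_of_pos hx0 (4 * δ)
      nlinarith
    · intro x hx
      have hx0 : 0 < x := by linarith
      obtain ⟨h1, -, h2⟩ := hC₄ _ (hεpos x hx) (hε x hx) (hε1 x hx)
      obtain ⟨h3, -, h4⟩ := hC₃ _ (hεpos x hx) (hε x hx) (hε1 x hx)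
      obtain ⟨h5, h6⟩ := hv.integral_rpow_stoppedMap hA hε ha (4 * δ) hx h1
      obtain ⟨h7, h8⟩ := hv.integral_rpow_stoppedMap hA hε ha (3 * δ) hx h3
      rw [integral_sub h5 h7, h6, h8, hsplit x hx0]
      rw [hs2 x hx0] at h2 h4 ⊢
      have h10 := drift_rpow_nonneg (hspos x hx0) (hs1 x (by linarith)) (by positivity)
        (by linarith) hκ4 hC₃0 (hA₀ x (hgood x hx)).2.2 h2 h4
      have h11 := mul_nonneg (Real.rpow_pos_of_pos hx0 (4 * δ)).le h10
      linarith

end StochasticBilliard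

theorem mainTheorem10 (ν : MeasureTheory.Measure ℝ) [MeasureTheory.IsProbabilityMeasure ν]
    (hν : StochasticBilliard.IsReflectionLaw ν) (hnd : ¬ StochasticBilliard.IsDegenerate ν)
    (γ : ℝ) (hγ : γ < 1) :
    (γ = StochasticBilliard.gammaCrit ν → 0 < γ →
      StochasticBilliard.NullRecurrentForLargeA.{u} ν (fun x => x ^ γ)) ∧
    (γ = -StochasticBilliard.meanTanSq ν → γ < 0 →
      StochasticBilliard.NullRecurrentForLargeA.{u} ν (fun x => x ^ γ)) := by
  have hm0 : 0 ≤ StochasticBilliard.meanTanSq ν := integral_nonneg fun x => sq_nonneg _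
  constructor
  · intro h h0
    -- A zero second moment would make γ_c zero, against γ > 0.
    have hm : 0 < StochasticBilliard.meanTanSq ν := by
      refine hm0.lt_of_ne fun h1 => ?_
      rw [h, StochasticBilliard.gammaCrit, ← h1, zero_div] at h0
      exact lt_irrefl _ h0
    have e : γ * (1 + 2 * StochasticBilliard.meanTanSq ν) = StochasticBilliard.meanTanSq ν := by
      rw [h, StochasticBilliard.gammaCrit, div_mul_cancel₀]
      positivity
    refine StochasticBilliard.nullRecurrentForLargeA_rpow hν hγ hm ?_ ?_
    · rw [StochasticBilliard.driftCoeff, e]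
      linarith
    · rw [StochasticBilliard.driftCoeff, e]
      nlinarith
  · intro h h0
    have hm : 0 < StochasticBilliard.meanTanSq ν := by linarith
    refine StochasticBilliard.nullRecurrentForLargeA_rpow hν hγ hm ?_ ?_
    · rw [StochasticBilliard.driftCoeff, h]
      nlinarith
    · rw [StochasticBilliard.driftCoeff, h]
      nlinarith
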